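/- All series below are formal power series in $q$ with coefficients in $\mathbb C[T]$, where $T$ is a formal variable. **Zeta values.** Write $\mathbf e$ for "even" and $\mathbf o$ for "odd". For $k\ge2$ let $\zeta^{\mathbf e}(k)=\sum_{n>0\text{ even}}n^{-k}$ and $\zeta^{\mathbf o}(k)=\sum_{n>0\text{ odd}}n^{-k}$. For $r\ge2$, $s\ge1$ and $(a,b)\in\{(\mathbf e,\mathbf o),(\mathbf o,\mathbf e),(\mathbf o,\mathbf o)\}$ let $\zeta^{ab}(r,s)=\sum m^{-r}n^{-s}$ over $m>n>0$ with $m$ of parity $a$ and $n$ of parity $b$. Put $L=\sum_{m\ge1}(-1)^m/m=-\log2$ and regularize by $\zeta^{\mathbf o}(1)=\tfrac12(T-L)$, $\zeta^{\mathbf e}(1)=\tfrac12(T+L)$ and, for $s\ge2$, $$\zeta^{\mathbf{eo}}(1,s)=\tfrac12\zeta^{\mathbf o}(s)T+\tfrac12L\,\zeta^{\mathbf o}(s)-\zeta^{\mathbf{oe}}(s,1),$$ $$\zeta^{\mathbf{oe}}(1,s)=\tfrac12\zeta^{\mathbf e}(s)T-\tfrac12L\,\zeta^{\mathbf e}(s)-\zeta^{\mathbf{eo}}(s,1),$$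 $$\zeta^{\mathbf{oo}}(1,s)=\tfrac12\zeta^{\mathbf o}(s)T-\tfrac12L\,\zeta^{\mathbf o}(s)-\zeta^{\mathbf{oo}}(s,1)-\zeta^{\mathbf o}(s+1).$$ A tilde denotes division by $(2\pi i)^{k}$, where $k$ is the weight: $\widetilde\zeta^{a}(k)=(2\pi i)^{-k}\zeta^{a}(k)$ and $\widetilde\zeta^{ab}(r,s)=(2\pi i)^{-r-s}\zeta^{ab}(r,s)$. **Rational $q$-series.** Let $\chi_{\mathbf e}(u)=1$, $\chi_{\mathbf o}(u)=(-1)^u$ and $c_r=\frac{(-1)^r}{2^r(r-1)!}$. Define $$g^a_r=c_r\sum_{u,m>0}\chi_a(u)u^{r-1}q^{um}\ (r\ge1),\qquad \bar g^a_r=-c_{r+1}\sum_{u,m>0}m\,\chi_a(u)u^{r}q^{um}\ (r\ge0),$$ $$g^{ab}_{r,s}=c_rc_s\sum_{m>m'>0,\ u,v>0}\chi_a(u)\chi_b(v)u^{r-1}v^{s-1}q^{um+vm'}.$$ With $B_r$ the Bernoulli numbers ($B_1=-\tfrac12$), let $\beta^{\mathbf e}_r=-\frac{B_r}{2^{r+1}r!}$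 and $\beta^{\mathbf o}_r=-\frac{(1-2^{-r})B_r}{2\,r!}$. For a family $x=(x^{\mathbf e}_p,x^{\mathbf o}_p)$ let, with $\delta$ the Kronecker delta, $$S^{\mathbf{eo}}_{r,s}(x;p,h)=\Bigl((-1)^s\tbinom{p-1}{s-1}+\delta_{p,s}\Bigr)x^{\mathbf o}_pg^{\mathbf e}_h+(-1)^{p+r}\tbinom{p-1}{r-1}x^{\mathbf o}_pg^{\mathbf o}_h,$$ $$S^{\mathbf{oe}}_{r,s}(x;p,h)=(-1)^s\tbinom{p-1}{s-1}x^{\mathbf o}_pg^{\mathbf o}_h+\delta_{p,s}x^{\mathbf e}_pg^{\mathbf o}_h+(-1)^{p+r}\tbinom{p-1}{r-1}x^{\mathbf o}_pg^{\mathbf e}_h,$$ $$S^{\mathbf{oo}}_{r,s}(x;p,h)=\Bigl((-1)^s\tbinom{p-1}{s-1}+(-1)^{p+r}\tbinom{p-1}{r-1}\Bigr)x^{\mathbf e}_pg^{\mathbf o}_h+\delta_{p,s}x^{\mathbf o}_pg^{\mathbf o}_h.$$ Put $$\beta^{ab}_{r,s}=\sum_{p+h=r+s,\ p,h\ge1}S^{ab}_{r,s}(\beta;p,h),\qquad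 I^{ab}_{r,s}=\sum_{p+h=r+s,\ p,h\ge1,\ p\text{ odd}}S^{ab}_{r,s}(\widetilde\zeta;p,h),$$ $$\varepsilon^{ab}_{r,s}=\delta_{r,2}\bar g^b_s-\delta_{r,1}\bar g^b_{s-1}+\delta_{s,1}(\bar g^a_{r-1}+g^a_r)\qquad((r,s)\ne(1,1)).$$ **Eisenstein series.** For $k\ge1$ put $G^{\mathbf o}_k=\widetilde\zeta^{\mathbf o}(k)+g^{\mathbf o}_k$ and $G^{\mathbf e}_k=\widetilde\zeta^{\mathbf e}(k)+g^{\mathbf e}_k$. For $r,s\ge1$, $(r,s)\ne(1,1)$, the double Eisenstein series of level 2 are $$G^{ab}_{r,s}=\widetilde\zeta^{ab}(r,s)+\Bigl(g^{ab}_{r,s}+\beta^{ab}_{r,s}+\tfrac14\varepsilon^{ab}_{r,s}\Bigr)+I^{ab}_{r,s}\qquad(ab=\mathbf{eo},\mathbf{oe},\mathbf{oo}).$$ **Theorem.** For all integers $r,s\ge1$ with $(r,s)\ne(1,1)$, $$G^{\mathbf o}_rG^{\mathbf e}_s+\tfrac14\bigl(\delta_{r,2}\bar g^{\mathbf e}_s+\delta_{s,2}\bar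 g^{\mathbf o}_r\bigr)+\tfrac18\bigl(\delta_{r,1}g^{\mathbf e}_s+\delta_{s,1}g^{\mathbf o}_r\bigr)=G^{\mathbf{oe}}_{r,s}+G^{\mathbf{eo}}_{s,r}=\sum_{\substack{i+j=r+s\\ i,j\ge1}}\Bigl(\tbinom{i-1}{r-1}G^{\mathbf{oe}}_{i,j}+\tbinom{i-1}{s-1}G^{\mathbf{oo}}_{i,j}\Bigr),$$ $$G^{\mathbf o}_rG^{\mathbf o}_s+\tfrac14\bigl(\delta_{r,2}\bar g^{\mathbf o}_s+\delta_{s,2}\bar g^{\mathbf o}_r\bigr)+\tfrac18\bigl(\delta_{r,1}g^{\mathbf o}_s+\delta_{s,1}g^{\mathbf o}_r\bigr)=G^{\mathbf{oo}}_{r,s}+G^{\mathbf{oo}}_{s,r}+G^{\mathbf o}_{r+s}=\sum_{\substack{i+j=r+s\\ i,j\ge1}}\Bigl(\tbinom{i-1}{r-1}+\tbinom{i-1}{s-1}\Bigr)G^{\mathbf{eo}}_{i,j}.$$ -/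

import Mathlib

namespace LevelTwo

noncomputable section

/-- The two parities: `ev` for even, `od` for odd. -/
inductive Par
  | ev
  | od

/-- The residue modulo 2 of a parity. -/
def Par.res : Par → ℕ
  | .ev => 0
  | .od => 1

/-- The sign attached to a parity: `1` for `ev` and `(-1)^u` for `od`. -/
def Par.sgn : Par → ℕ → ℚ
  | .ev, _ => 1
  | .od, u => (-1) ^ u

/-- The pairs `(p, h)` of integers with `p + h = k` and `p, h ≥ 1`. -/
def posPairs (k : ℕ) : Finset (ℕ × ℕ) :=
  (Finset.HasAntidiagonal.antidiagonal k).filter (fun x => 1 ≤ x.1 ∧ 1 ≤ x.2)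

/-! ### Zeta values and double zeta values of level 2, with values in `ℂ[T]` -/

/-- The sum of `1 / n ^ k` over the positive integers `n` of parity `a` (convergent for `k ≥ 2`). -/
def zetaSeries (a : Par) (k : ℕ) : ℝ :=
  ∑' n : ℕ, if 0 < n ∧ n % 2 = a.res then 1 / (n : ℝ) ^ k else 0

/-- The sum of `1 / (m ^ r * n ^ s)` over `m > n > 0` with `m` of parity `a` and `n` of parity `b`
(absolutely convergent for `r ≥ 2`, `s ≥ 1`). -/
def dzetaSeries (a b : Par) (r s : ℕ) : ℝ :=
  ∑' x : ℕ × ℕ,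
    if x.2 < x.1 ∧ 0 < x.2 ∧ x.1 % 2 = a.res ∧ x.2 % 2 = b.res then
      1 / ((x.1 : ℝ) ^ r * (x.2 : ℝ) ^ s)
    else 0

/-- A real number as a constant of `ℂ[T]`. -/
def cst (x : ℝ) : Polynomial ℂ := Polynomial.C (x : ℂ)

/-- The formal variable `T`. -/
def T : Polynomial ℂ := Polynomial.X

/-- The value `∑_{m ≥ 1} (-1)^m / m = -log 2`. -/
def L1 : ℝ := -Real.log 2

/-- The (regularized, if `k = 1`) value `ζ^e(k)`. -/
def zetaE (k : ℕ) : Polynomial ℂ :=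
  if k = 1 then cst (1 / 2) * (T + cst L1) else cst (zetaSeries .ev k)

/-- The (regularized, if `k = 1`) value `ζ^o(k)`. -/
def zetaO (k : ℕ) : Polynomial ℂ :=
  if k = 1 then cst (1 / 2) * (T - cst L1) else cst (zetaSeries .od k)

/-- The double zeta value `ζ^{eo}(r, s)`, regularized if `r = 1` (and then `s ≥ 2`). -/
def zetaEO (r s : ℕ) : Polynomial ℂ :=
  if r = 1 then
    cst (1 / 2) * zetaO s * T + cst (1 / 2) * cst L1 * zetaO s - cst (dzetaSeries .od .ev s 1)
  else cst (dzetaSeries .ev .od r s)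

/-- The double zeta value `ζ^{oe}(r, s)`, regularized if `r = 1` (and then `s ≥ 2`). -/
def zetaOE (r s : ℕ) : Polynomial ℂ :=
  if r = 1 then
    cst (1 / 2) * zetaE s * T - cst (1 / 2) * cst L1 * zetaE s - cst (dzetaSeries .ev .od s 1)
  else cst (dzetaSeries .od .ev r s)

/-- The double zeta value `ζ^{oo}(r, s)`, regularized if `r = 1` (and then `s ≥ 2`). -/
def zetaOO (r s : ℕ) : Polynomial ℂ :=
  if r = 1 then
    cst (1 / 2) * zetaO s * T - cst (1 / 2) * cst L1 * zetaO s - cst (dzetaSeries .od .od s 1)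
      - zetaO (s + 1)
  else cst (dzetaSeries .od .od r s)

/-- For `z` of weight `k`, the normalized value `(2πi)^{-k} z`, as a constant `q`-series. -/
def normalize (k : ℕ) (z : Polynomial ℂ) : PowerSeries (Polynomial ℂ) :=
  PowerSeries.C (Polynomial.C (((2 * (Real.pi : ℂ) * Complex.I) ^ k)⁻¹) * z)

/-- `(2πi)^{-k} ζ^e(k)`. -/
def nzetaE (k : ℕ) : PowerSeries (Polynomial ℂ) := normalize k (zetaE k)

/-- `(2πi)^{-k} ζ^o(k)`. -/
def nzetaO (k : ℕ) : PowerSeries (Polynomial ℂ) := normalize k (zetaO k)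

/-! ### The rational `q`-series -/

/-- The coefficient of `q^{u/2}` in `φ_r^a(q) = (-1)^r / (2^r (r-1)!) ∑_{u>0} sgn_a(u) u^{r-1} q^{u/2}`. -/
def phiCoeff (a : Par) (r u : ℕ) : ℚ :=
  (-1) ^ r / (2 ^ r * ((r - 1).factorial : ℚ)) * a.sgn u * (u : ℚ) ^ (r - 1)

/-- `g_r^a(q) = ∑_{m>0} φ_r^a(q^{2m})`, a sum over `u, m > 0` of terms in `q^{um}`. -/
def g (a : Par) (r : ℕ) : PowerSeries ℚ :=
  PowerSeries.mk fun n => ∑ x ∈ n.divisorsAntidiagonal, phiCoeff a r x.1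

/-- `\bar g_r^a(q) = -∑_{m>0} m φ_{r+1}^a(q^{2m})`. -/
def gbar (a : Par) (r : ℕ) : PowerSeries ℚ :=
  PowerSeries.mk fun n => -∑ x ∈ n.divisorsAntidiagonal, (x.2 : ℚ) * phiCoeff a (r + 1) x.1

/-- `g_{r,s}^{ab}(q) = ∑_{m>m'>0} φ_r^a(q^{2m}) φ_s^b(q^{2m'})`: the coefficient of `q^n` is a sum
over `u, m, v, m' > 0` with `um + vm' = n` and `m > m'`. -/
def gg (a b : Par) (r s : ℕ) : PowerSeries ℚ :=
  PowerSeries.mk fun n =>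
    ∑ c ∈ Finset.HasAntidiagonal.antidiagonal n,
      ∑ x ∈ c.1.divisorsAntidiagonal, ∑ y ∈ c.2.divisorsAntidiagonal,
        if y.2 < x.2 then phiCoeff a r x.1 * phiCoeff b s y.1 else 0

/-- `β_r^e = -B_r / (2^{r+1} r!)`. -/
def betaE (r : ℕ) : ℚ := -bernoulli r / (2 ^ (r + 1) * (r.factorial : ℚ))

/-- `β_r^o = -(1 - 2^{-r}) B_r / (2 r!)`. -/
def betaO (r : ℕ) : ℚ := -((1 - (2 ^ r)⁻¹) * bernoulli r) / (2 * (r.factorial : ℚ))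

/-- Kronecker's delta. -/
def kron (i j : ℕ) : ℚ := if i = j then 1 else 0

/-- The coefficient `(-1)^s binom(p-1, s-1)`. -/
def cfOne (s p : ℕ) : ℚ := (-1) ^ s * ((p - 1).choose (s - 1) : ℚ)

/-- The coefficient `(-1)^{p+r} binom(p-1, r-1)`. -/
def cfTwo (r p : ℕ) : ℚ := (-1) ^ (p + r) * ((p - 1).choose (r - 1) : ℚ)

def betaEO (r s : ℕ) : PowerSeries ℚ :=
  ∑ x ∈ posPairs (r + s),
    (((cfOne s x.1 + kron x.1 s) * betaO x.1) • g .ev x.2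
      + (cfTwo r x.1 * betaO x.1) • g .od x.2)

def betaOE (r s : ℕ) : PowerSeries ℚ :=
  ∑ x ∈ posPairs (r + s),
    ((cfOne s x.1 * betaO x.1) • g .od x.2
      + (kron x.1 s * betaE x.1) • g .od x.2
      + (cfTwo r x.1 * betaO x.1) • g .ev x.2)

def betaOO (r s : ℕ) : PowerSeries ℚ :=
  ∑ x ∈ posPairs (r + s),
    (((cfOne s x.1 + cfTwo r x.1) * betaE x.1) • g .od x.2
      + (kron x.1 s * betaO x.1) • g .od x.2)

def alphaOne : PowerSeries ℚ := gbar .od 0 - (1 / 2 : ℚ) • gbar .ev 0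

def alphaTwo : PowerSeries ℚ := -alphaOne

def alphaThree : PowerSeries ℚ := (4 : ℚ) • g .od 2 + (1 / 2 : ℚ) • gbar .ev 0

def epsEO (r s : ℕ) : PowerSeries ℚ :=
  kron r 2 • gbar .od s - kron r 1 • gbar .od (s - 1)
    + kron s 1 • (gbar .ev (r - 1) + g .ev r) + (kron r 1 * kron s 1) • alphaOne

def epsOE (r s : ℕ) : PowerSeries ℚ :=
  kron r 2 • gbar .ev s - kron r 1 • gbar .ev (s - 1)
    + kron s 1 • (gbar .od (r - 1) + g .od r) + (kron r 1 * kron s 1) • alphaTwo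

def epsOO (r s : ℕ) : PowerSeries ℚ :=
  kron r 2 • gbar .od s - kron r 1 • gbar .od (s - 1)
    + kron s 1 • (gbar .od (r - 1) + g .od r) + (kron r 1 * kron s 1) • alphaThree

/-- The combinatorial double Eisenstein series `C^{eo}_{r,s}`. -/
def combEO (r s : ℕ) : PowerSeries ℚ :=
  gg .ev .od r s + betaEO r s + (1 / 4 : ℚ) • epsEO r s

/-- The combinatorial double Eisenstein series `C^{oe}_{r,s}`. -/
def combOE (r s : ℕ) : PowerSeries ℚ :=
  gg .od .ev r s + betaOE r s + (1 / 4 : ℚ) • epsOE r s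

/-- The combinatorial double Eisenstein series `C^{oo}_{r,s}`. -/
def combOO (r s : ℕ) : PowerSeries ℚ :=
  gg .od .od r s + betaOO r s + (1 / 4 : ℚ) • epsOO r s

/-! ### The Eisenstein series, as elements of `ℂ[T][[q]]` -/

/-- The inclusion of `ℚ[[q]]` in `ℂ[T][[q]]`. -/
def incl : PowerSeries ℚ →+* PowerSeries (Polynomial ℂ) :=
  PowerSeries.map (algebraMap ℚ (Polynomial ℂ))

/-- The imaginary part `I^{eo}_{r,s}`: the sum is over `p + h = r + s` with `p` odd. -/
def imagEO (r s : ℕ) : PowerSeries (Polynomial ℂ) :=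
  ∑ x ∈ (posPairs (r + s)).filter (fun x => Odd x.1),
    (nzetaO x.1 * incl ((cfOne s x.1 + kron x.1 s) • g .ev x.2)
      + nzetaO x.1 * incl (cfTwo r x.1 • g .od x.2))

/-- The imaginary part `I^{oe}_{r,s}`. -/
def imagOE (r s : ℕ) : PowerSeries (Polynomial ℂ) :=
  ∑ x ∈ (posPairs (r + s)).filter (fun x => Odd x.1),
    (nzetaO x.1 * incl (cfOne s x.1 • g .od x.2)
      + nzetaE x.1 * incl (kron x.1 s • g .od x.2)
      + nzetaO x.1 * incl (cfTwo r x.1 • g .ev x.2))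

/-- The imaginary part `I^{oo}_{r,s}`. -/
def imagOO (r s : ℕ) : PowerSeries (Polynomial ℂ) :=
  ∑ x ∈ (posPairs (r + s)).filter (fun x => Odd x.1),
    (nzetaE x.1 * incl ((cfOne s x.1 + cfTwo r x.1) • g .od x.2)
      + nzetaO x.1 * incl (kron x.1 s • g .od x.2))

/-- The double Eisenstein series `G^{eo}_{r,s}(q)`, for `r, s ≥ 1` and `(r, s) ≠ (1, 1)`. -/
def GEO (r s : ℕ) : PowerSeries (Polynomial ℂ) :=
  normalize (r + s) (zetaEO r s) + incl (combEO r s) + imagEO r s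

/-- The double Eisenstein series `G^{oe}_{r,s}(q)`, for `r, s ≥ 1` and `(r, s) ≠ (1, 1)`. -/
def GOE (r s : ℕ) : PowerSeries (Polynomial ℂ) :=
  normalize (r + s) (zetaOE r s) + incl (combOE r s) + imagOE r s

/-- The double Eisenstein series `G^{oo}_{r,s}(q)`, for `r, s ≥ 1` and `(r, s) ≠ (1, 1)`. -/
def GOO (r s : ℕ) : PowerSeries (Polynomial ℂ) :=
  normalize (r + s) (zetaOO r s) + incl (combOO r s) + imagOO r s

/-- The Eisenstein series `G^e_k(q)`, for `k ≥ 1`. -/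
def GE (k : ℕ) : PowerSeries (Polynomial ℂ) := nzetaE k + incl (g .ev k)

/-- The Eisenstein series `G^o_k(q)`, for `k ≥ 1`. -/
def GO (k : ℕ) : PowerSeries (Polynomial ℂ) := nzetaO k + incl (g .od k)

end

end LevelTwo

namespace LevelTwo
open Finset hiding antidiagonal mem_antidiagonal
open Finset.HasAntidiagonal (antidiagonal mem_antidiagonal)
open Filter Topology
noncomputable section

/-! Each double Eisenstein series has four pieces: a double zeta value, the lattice sum `gg`, a part
linear in the series g with constant coefficients, and ε/4. A product of two Eisenstein series
splits into zeta·zeta, the mixed terms zeta·g, and g·g. Both relations are checked piece by piece.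

Linear constants. By Euler's formula β_p is the normalized zeta value for even p; it vanishes for
odd p ≥ 3 and equals 1/8 for p = 1. So β and the imaginary part together form one sum of S(x; p, h)
with x_p = ζ̃(p) + δ_{p,1}/8 (`regO_eq`, `regE_eq`). This is the origin of the terms with factor
1/8.

Stuffle. In g·g the regions m > m' and m < m' give the two lattice sums. The diagonal m = m' is a
convolution over u + v = w, evaluated by Euler–Maclaurin summation (`convPow_one`) or its
alternating form due to Boole (`convPow_neg_one`). Its coefficients are -(1 + (-1)^p) β_p, plus 1/4
at p = 1. The linear parts produce the same factor 1 + (-1)^p, which kills the zeta values of odd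
weight, so the two cancel; ε/4 accounts for the leftover 1/4. The integral term of Euler–Maclaurin
is g^o_{r+s}.

Shuffle. Exchanging u with m and v with m', g·g is split by comparing u with v (`qsum_shuffle`). The
binomial theorem gives the coefficients (`g_shuffle`), and the diagonal u = v contributes ḡ + g,
which is what the ε sum supplies. The linear parts collapse to the mixed terms for arbitrary
constants, by finite differences of binomial coefficients (`sum_shuffle_od_ev`,
`sum_shuffle_od_od`).

Zeta values. Stuffle is the ordering of (m, n), shuffle is partial fractions. If an exponent is 1,
the divergent term is subtracted first; the remaining sum of 1/m - 1/(m + n) telescopes up to ±log 2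
(`zeta_shuffle_one`), and the regularization is exactly what restores the relations. -/

/-! ### Divided powers and the binomial theorem -/

/-- The divided power `x ^ n / n!`. -/
def divPow (n : ℕ) (x : ℚ) : ℚ := x ^ n / n.factorial

/-- Absorbing (-1/2)^r into u^r makes the coefficients divided powers at -u/2, so that binomial
identities apply to them. -/
theorem phiCoeff_succ (a : Par) (r u : ℕ) :
    phiCoeff a (r + 1) u = -(1 / 2) * a.sgn u * divPow r (-(u : ℚ) / 2) := by
  simp only [phiCoeff, divPow, Nat.add_sub_cancel, div_pow, neg_pow (u : ℚ), pow_succ]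
  field_simp

theorem divPow_add (n : ℕ) (x y : ℚ) :
    divPow n (x + y) = ∑ p ∈ antidiagonal n, divPow p.1 x * divPow p.2 y := by
  rw [divPow, add_pow, Finset.Nat.sum_antidiagonal_eq_sum_range_succ
    (fun i j => divPow i x * divPow j y), Finset.sum_div]
  refine Finset.sum_congr rfl fun i hi => ?_
  have hi' : i ≤ n := by simpa [Nat.lt_succ_iff] using hi
  have := Nat.choose_mul_factorial_mul_factorial hi'
  have h2 : (n.choose i : ℚ) = n.factorial / (i.factorial * (n - i).factorial) := by
    rw [Nat.cast_choose ℚ hi']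
  rw [h2, divPow, divPow]
  field_simp

theorem mul_divPow (n : ℕ) (x : ℚ) : x * divPow n x = (n + 1) * divPow (n + 1) x := by
  simp only [divPow, Nat.factorial_succ, pow_succ, Nat.cast_mul, Nat.cast_succ]
  field_simp

theorem divPow_mul (a b : ℕ) (x : ℚ) :
    divPow a x * divPow b x = (a + b).choose a * divPow (a + b) x := by
  rw [Nat.cast_choose ℚ (Nat.le_add_right a b), Nat.add_sub_cancel_left]
  simp only [divPow, pow_add]
  field_simp

/-- For p.1 = a + i the binomial coefficient splits x^{a+i}/(a+i)! into divided powers of orders a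
and i; what remains is the binomial theorem for (x + y)^b. -/
theorem sum_choose_mul_divPow (a b : ℕ) (x y : ℚ) :
    ∑ p ∈ antidiagonal (a + b), (p.1.choose a : ℚ) * (divPow p.1 x * divPow p.2 y)
      = divPow a x * divPow b (x + y) := by
  rw [divPow_add, Finset.mul_sum]
  symm
  refine Finset.sum_of_injOn (fun p => (a + p.1, p.2)) ?_ ?_ ?_ ?_
  · rintro ⟨i, j⟩ _ ⟨i', j'⟩ _ h
    simpa using h
  · rintro ⟨i, j⟩ h
    simp at h ⊢
    omega
  · rintro ⟨i, j⟩ h h2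
    have : i < a := by
      by_contra hlt
      apply h2
      simp only [mem_antidiagonal] at h
      refine ⟨(i - a, j), ?_, ?_⟩
      · simp; omega
      · simp; omega
    simp [Nat.choose_eq_zero_of_lt this]
  · rintro ⟨i, j⟩ h
    simp only
    rw [← mul_assoc, divPow_mul, mul_assoc]

/-! ### Lattice sums and their stuffle and shuffle decompositions -/

/-- `∑_{u, m > 0} f(u, m) q^{um}`. -/
def dsum : (ℕ → ℕ → ℚ) →ₗ[ℚ] PowerSeries ℚ where
  toFun f := PowerSeries.mk fun n => ∑ x ∈ n.divisorsAntidiagonal, f x.1 x.2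
  map_add' f g := by ext n; simp [Finset.sum_add_distrib]
  map_smul' c f := by ext n; simp [Finset.mul_sum]

/-- `∑_{u, m, v, m' > 0} F(u, m, v, m') q^{um + vm'}`. -/
def qsum : (ℕ → ℕ → ℕ → ℕ → ℚ) →ₗ[ℚ] PowerSeries ℚ where
  toFun F := PowerSeries.mk fun n => ∑ c ∈ antidiagonal n,
      ∑ x ∈ c.1.divisorsAntidiagonal, ∑ y ∈ c.2.divisorsAntidiagonal, F x.1 x.2 y.1 y.2
  map_add' f g := by ext n; simp [Finset.sum_add_distrib]
  map_smul' c f := by ext n; simp [Finset.mul_sum]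

theorem dsum_congr {f f' : ℕ → ℕ → ℚ} (h : ∀ u m, 0 < u → 0 < m → f u m = f' u m) :
    dsum f = dsum f' := by
  ext n
  simp only [dsum, LinearMap.coe_mk, AddHom.coe_mk, PowerSeries.coeff_mk]
  refine Finset.sum_congr rfl fun x hx => h _ _ ?_ ?_
  · exact Nat.pos_of_ne_zero (Nat.left_ne_zero_of_mem_divisorsAntidiagonal hx)
  · exact Nat.pos_of_ne_zero (Nat.right_ne_zero_of_mem_divisorsAntidiagonal hx)

/-- The quadruples of positive integers with `um + vm' = n`. -/
def quads (n : ℕ) : Finset (ℕ × ℕ × ℕ × ℕ) :=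
  (range (n + 1) ×ˢ range (n + 1) ×ˢ range (n + 1) ×ˢ range (n + 1)).filter fun x =>
    0 < x.1 ∧ 0 < x.2.1 ∧ 0 < x.2.2.1 ∧ 0 < x.2.2.2 ∧ x.1 * x.2.1 + x.2.2.1 * x.2.2.2 = n

theorem mem_quads {n u m v m' : ℕ} :
    (u, m, v, m') ∈ quads n ↔ 0 < u ∧ 0 < m ∧ 0 < v ∧ 0 < m' ∧ u * m + v * m' = n := by
  simp only [quads, mem_filter, mem_product, mem_range, and_iff_right_iff_imp]
  rintro ⟨h1, h2, h3, h4, rfl⟩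
  refine ⟨?_, ?_, ?_, ?_⟩ <;> nlinarith [Nat.mul_pos h1 h2, Nat.mul_pos h3 h4]

theorem coeff_qsum (F : ℕ → ℕ → ℕ → ℕ → ℚ) (n : ℕ) :
    PowerSeries.coeff n (qsum F) = ∑ x ∈ quads n, F x.1 x.2.1 x.2.2.1 x.2.2.2 := by
  simp only [qsum, LinearMap.coe_mk, AddHom.coe_mk, PowerSeries.coeff_mk]
  simp_rw [← Finset.sum_product']
  rw [Finset.sum_sigma']
  refine Finset.sum_nbij' (fun x => (x.2.1.1, x.2.1.2, x.2.2.1, x.2.2.2))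
    (fun x => ⟨(x.1 * x.2.1, x.2.2.1 * x.2.2.2), ((x.1, x.2.1), (x.2.2.1, x.2.2.2))⟩) ?_ ?_ ?_ ?_ ?_
  · rintro ⟨⟨c, d⟩, ⟨u, m⟩, ⟨v, m'⟩⟩ h
    simp only [mem_sigma, mem_antidiagonal, mem_product, Nat.mem_divisorsAntidiagonal] at h
    obtain ⟨rfl, ⟨rfl, h1⟩, rfl, h2⟩ := h
    simp only [mem_quads]
    simp only [ne_eq, mul_eq_zero, not_or] at h1 h2
    exact ⟨by omega, by omega, by omega, by omega, trivial⟩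
  · rintro ⟨u, m, v, m'⟩ h
    rw [mem_quads] at h
    simp only [mem_sigma, mem_antidiagonal, mem_product, Nat.mem_divisorsAntidiagonal, ne_eq,
      mul_eq_zero, not_or, true_and]
    exact ⟨h.2.2.2.2, by omega, by omega⟩
  · rintro ⟨⟨c, d⟩, ⟨u, m⟩, ⟨v, m'⟩⟩ h
    simp only [mem_sigma, mem_antidiagonal, mem_product, Nat.mem_divisorsAntidiagonal] at h
    obtain ⟨rfl, ⟨rfl, h1⟩, rfl, h2⟩ := h
    rfl
  · rintro ⟨u, m, v, m'⟩ h
    rfl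
  · rintro _ _
    rfl

theorem coeff_dsum (f : ℕ → ℕ → ℚ) (n : ℕ) :
    PowerSeries.coeff n (dsum f) = ∑ x ∈ n.divisorsAntidiagonal, f x.1 x.2 := by
  simp [dsum]

theorem qsum_congr {F F' : ℕ → ℕ → ℕ → ℕ → ℚ}
    (h : ∀ u m v m', 0 < u → 0 < m → 0 < v → 0 < m' → F u m v m' = F' u m v m') :
    qsum F = qsum F' := by
  ext n
  rw [coeff_qsum, coeff_qsum]
  refine Finset.sum_congr rfl ?_
  rintro ⟨u, m, v, m'⟩ hx
  rw [mem_quads] at hx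
  exact h _ _ _ _ hx.1 hx.2.1 hx.2.2.1 hx.2.2.2.1

theorem qsum_swap (F : ℕ → ℕ → ℕ → ℕ → ℚ) :
    qsum F = qsum fun u m v m' => F v m' u m := by
  ext n
  rw [coeff_qsum, coeff_qsum]
  refine Finset.sum_nbij' (fun x => (x.2.2.1, x.2.2.2, x.1, x.2.1))
    (fun x => (x.2.2.1, x.2.2.2, x.1, x.2.1)) ?_ ?_ ?_ ?_ ?_
  · rintro ⟨u, m, v, m'⟩ h
    rw [mem_quads] at h ⊢
    rw [add_comm]
    tauto
  · rintro ⟨u, m, v, m'⟩ h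
    rw [mem_quads] at h ⊢
    rw [add_comm]
    tauto
  all_goals rintro _ _; rfl

/-- On m = m' the exponent is (u + v)m, so w = u + v becomes the summation variable. -/
theorem qsum_diagonal_right (F : ℕ → ℕ → ℕ → ℕ → ℚ) :
    qsum (fun u m v m' => if m = m' then F u m v m' else 0) = dsum fun w m =>
      ∑ p ∈ antidiagonal w, if 0 < p.1 ∧ 0 < p.2 then F p.1 m p.2 m else 0 := by
  ext n
  rw [coeff_qsum, coeff_dsum]
  simp_rw [← Finset.sum_filter]
  rw [Finset.sum_sigma']
  refine Finset.sum_nbij' (fun x => ⟨(x.1 + x.2.2.1, x.2.1), (x.1, x.2.2.1)⟩)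
    (fun x => (x.2.1, x.1.2, x.2.2, x.1.2)) ?_ ?_ ?_ ?_ ?_
  · rintro ⟨u, m, v, m'⟩ h
    rw [mem_filter, mem_quads] at h
    obtain ⟨⟨h1, h2, h3, h4, rfl⟩, h5⟩ := h
    simp only at h5
    subst h5
    simp only [mem_sigma, Nat.mem_divisorsAntidiagonal, mem_filter, mem_antidiagonal]
    have := Nat.mul_pos h1 h2
    exact ⟨⟨by ring, by omega⟩, trivial, h1, h3⟩
  · rintro ⟨⟨w, m⟩, u, v⟩ h
    simp only [mem_sigma, Nat.mem_divisorsAntidiagonal, mem_filter, mem_antidiagonal] at h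
    obtain ⟨⟨rfl, h1⟩, rfl, h2, h3⟩ := h
    rw [mem_filter, mem_quads]
    simp only [ne_eq, mul_eq_zero, not_or] at h1
    have h4 : 0 < m := Nat.pos_of_ne_zero h1.2
    exact ⟨⟨h2, h4, h3, h4, by ring⟩, rfl⟩
  · rintro ⟨u, m, v, m'⟩ h
    rw [mem_filter, mem_quads] at h
    obtain ⟨⟨h1, h2, h3, h4, rfl⟩, h5⟩ := h
    simp only at h5
    subst h5
    rfl
  · rintro ⟨⟨w, m⟩, u, v⟩ h
    simp only [mem_sigma, Nat.mem_divisorsAntidiagonal, mem_filter, mem_antidiagonal] at h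
    obtain ⟨⟨rfl, h1⟩, rfl, h2, h3⟩ := h
    rfl
  · rintro ⟨u, m, v, m'⟩ h
    rw [mem_filter, mem_quads] at h
    obtain ⟨⟨h1, h2, h3, h4, rfl⟩, h5⟩ := h
    simp only at h5
    subst h5
    rfl

theorem qsum_comm (F : ℕ → ℕ → ℕ → ℕ → ℚ) :
    qsum F = qsum fun u m v m' => F m u m' v := by
  ext n
  rw [coeff_qsum, coeff_qsum]
  refine Finset.sum_nbij' (fun x => (x.2.1, x.1, x.2.2.2, x.2.2.1))
    (fun x => (x.2.1, x.1, x.2.2.2, x.2.2.1)) ?_ ?_ ?_ ?_ ?_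
  · rintro ⟨u, m, v, m'⟩ h
    rw [mem_quads] at h ⊢
    rw [mul_comm m, mul_comm m']
    tauto
  · rintro ⟨u, m, v, m'⟩ h
    rw [mem_quads] at h ⊢
    rw [mul_comm m, mul_comm m']
    tauto
  all_goals rintro _ _; rfl

theorem dsum_comm (f : ℕ → ℕ → ℚ) : dsum f = dsum fun u m => f m u := by
  ext n
  rw [coeff_dsum, coeff_dsum]
  exact Finset.sum_nbij' Prod.swap Prod.swap
    (fun x h => Nat.swap_mem_divisorsAntidiagonal.2 h)
    (fun x h => Nat.swap_mem_divisorsAntidiagonal.2 h)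
    (fun _ _ => rfl) (fun _ _ => rfl) (fun _ _ => rfl)

theorem qsum_trichotomy (F : ℕ → ℕ → ℕ → ℕ → ℚ) :
    qsum F = qsum (fun u m v m' => if m' < m then F u m v m' else 0)
      + qsum (fun u m v m' => if m' < m then F v m' u m else 0)
      + qsum (fun u m v m' => if m = m' then F u m v m' else 0) := by
  rw [qsum_swap (fun u m v m' => if m' < m then F v m' u m else 0), ← map_add, ← map_add]
  congr 1
  ext u m v m'
  simp only [Pi.add_apply]
  rcases lt_trichotomy m m' with h | h | h
  · simp [h, h.le.not_gt, h.ne]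
  · simp [h]
  · simp [h, h.le.not_gt, h.ne']

/-- Stuffle decomposition. -/
theorem qsum_stuffle (F : ℕ → ℕ → ℕ → ℕ → ℚ) :
    qsum F = qsum (fun u m v m' => if m' < m then F u m v m' else 0)
      + qsum (fun u m v m' => if m' < m then F v m' u m else 0)
      + dsum fun w m =>
        ∑ p ∈ antidiagonal w, if 0 < p.1 ∧ 0 < p.2 then F p.1 m p.2 m else 0 := by
  rw [← qsum_diagonal_right, ← qsum_trichotomy]

/-- Rewrite um + vm' = v(m + m') + (u - v)m: the condition v < u becomes positivity of u - v, and m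
< m + m' is the new inequality. -/
theorem qsum_lt_left (F : ℕ → ℕ → ℕ → ℕ → ℚ) :
    qsum (fun u m v m' => if v < u then F u m v m' else 0)
      = qsum fun u m v m' => if m' < m then F (u + v) m' u (m - m') else 0 := by
  ext n
  rw [coeff_qsum, coeff_qsum]
  simp_rw [← Finset.sum_filter]
  refine Finset.sum_nbij' (fun x => (x.2.2.1, x.2.1 + x.2.2.2, x.1 - x.2.2.1, x.2.1))
    (fun x => (x.1 + x.2.2.1, x.2.2.2, x.1, x.2.1 - x.2.2.2)) ?_ ?_ ?_ ?_ ?_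
  · rintro ⟨u, m, v, m'⟩ h
    rw [mem_filter, mem_quads] at h ⊢
    obtain ⟨⟨h1, h2, h3, h4, rfl⟩, h5⟩ := h
    simp only at h5
    obtain ⟨w, rfl⟩ := Nat.exists_eq_add_of_lt h5
    dsimp only
    refine ⟨⟨h3, by omega, by omega, h2, ?_⟩, by omega⟩
    rw [show v + w + 1 - v = w + 1 by omega]
    ring
  · rintro ⟨u, m, v, m'⟩ h
    rw [mem_filter, mem_quads] at h ⊢
    obtain ⟨⟨h1, h2, h3, h4, rfl⟩, h5⟩ := h
    simp only at h5
    obtain ⟨w, rfl⟩ := Nat.exists_eq_add_of_lt h5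
    dsimp only
    refine ⟨⟨by omega, by omega, by omega, by omega, ?_⟩, by omega⟩
    rw [show m' + w + 1 - m' = w + 1 by omega]
    ring
  · rintro ⟨u, m, v, m'⟩ h
    rw [mem_filter, mem_quads] at h
    obtain ⟨⟨h1, h2, h3, h4, rfl⟩, h5⟩ := h
    simp only at h5
    simp [h5.le]
  · rintro ⟨u, m, v, m'⟩ h
    rw [mem_filter, mem_quads] at h
    obtain ⟨⟨h1, h2, h3, h4, rfl⟩, h5⟩ := h
    simp only at h5
    simp [h5.le]
  · rintro ⟨u, m, v, m'⟩ h
    rw [mem_filter, mem_quads] at h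
    obtain ⟨⟨h1, h2, h3, h4, rfl⟩, h5⟩ := h
    simp only at h5
    simp only
    congr 1 <;> omega

/-- Shuffle decomposition. -/
theorem qsum_shuffle (F : ℕ → ℕ → ℚ) :
    qsum (fun u _ v _ => F u v) = qsum (fun u m v m' => if m' < m then F (u + v) u else 0)
      + qsum (fun u m v m' => if m' < m then F u (u + v) else 0)
      + dsum fun u m => ((m : ℚ) - 1) * F u u := by
  -- Trichotomy is applied to the conjugate sum, so in the original variables it compares u with v.
  have h1 := qsum_trichotomy (fun u m v m' => F m m')
  rw [qsum_comm (fun u m v m' => F m m')] at h1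
  rw [h1]
  rw [qsum_comm (fun u m v m' => if m' < m then F m m' else 0),
    qsum_comm (fun u m v m' => if m' < m then F m' m else 0),
    qsum_lt_left (fun u m v m' => F u v), qsum_lt_left (fun u m v m' => F v u)]
  congr 1
  rw [qsum_diagonal_right (fun u m v m' => F m m'), dsum_comm]
  refine dsum_congr fun u m _ hm => ?_
  rw [← Finset.sum_filter, Finset.sum_const, nsmul_eq_mul]
  congr 1
  -- On the diagonal u = v the two multiplicities are positive and sum to m, which leaves m - 1
  -- choices.
  have : (filter (fun p : ℕ × ℕ => 0 < p.1 ∧ 0 < p.2) (antidiagonal m)).card = m - 1 := by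
    rw [show m - 1 = (Ico 1 m).card by simp]
    refine Finset.card_nbij' (fun p => p.1) (fun i => (i, m - i)) ?_ ?_ ?_ ?_
    · rintro ⟨i, j⟩ h
      simp at h ⊢
      omega
    · rintro i h
      simp at h ⊢
      omega
    · rintro ⟨i, j⟩ h
      simp at h ⊢
      omega
    · rintro i h
      rfl
  rw [this, Nat.cast_sub hm, Nat.cast_one]

/-! ### The rational q-series as lattice sums -/

theorem g_eq_dsum (a : Par) (r : ℕ) : g a r = dsum fun u _ => phiCoeff a r u := rfl

theorem gbar_eq_dsum (a : Par) (r : ℕ) :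
    gbar a r = dsum fun u m => -((m : ℚ) * phiCoeff a (r + 1) u) := by
  ext n
  simp [gbar, coeff_dsum]

theorem gg_eq_qsum (a b : Par) (r s : ℕ) : gg a b r s
    = qsum fun u m v m' => if m' < m then phiCoeff a r u * phiCoeff b s v else 0 := rfl

theorem g_mul_g (a b : Par) (r s : ℕ) :
    g a r * g b s = qsum fun u _ v _ => phiCoeff a r u * phiCoeff b s v := by
  ext n
  simp only [g, PowerSeries.coeff_mul, PowerSeries.coeff_mk, qsum, LinearMap.coe_mk,
    AddHom.coe_mk, Finset.sum_mul_sum]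

/-! ### Euler–Maclaurin and Boole summation of convolutions -/

theorem cast_choose_succ_mul (i b : ℕ) :
    (i.choose (b + 1) : ℚ) * (b + 1) = i.choose b * ((i : ℚ) - b) := by
  rcases le_or_gt b i with h | h
  · have := Nat.choose_succ_right_eq i b
    rw [← Nat.cast_sub h]
    exact_mod_cast this
  · simp [Nat.choose_eq_zero_of_lt h, Nat.choose_eq_zero_of_lt (h.trans (Nat.lt_succ_self b))]

/-- `∑_{u + v = w, u, v > 0} σ^u (-u/2)^a/a! (-v/2)^b/b!`. -/
def convPow (σ : ℚ) (a b w : ℕ) : ℚ :=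
  ∑ p ∈ antidiagonal w, if 0 < p.1 ∧ 0 < p.2 then
    σ ^ p.1 * divPow a (-(p.1 : ℚ) / 2) * divPow b (-(p.2 : ℚ) / 2) else 0

theorem divPow_zero (x : ℚ) : divPow 0 x = 1 := by simp [divPow]

theorem divPow_at_zero (n : ℕ) : divPow n 0 = if n = 0 then 1 else 0 := by
  cases n <;> simp [divPow]

/-- The terms with u ≥ 2 are σ times those for w; the term u = 1 has v = w. -/
theorem convPow_zero_succ (σ : ℚ) (b w : ℕ) (hw : 0 < w) :
    convPow σ 0 b (w + 1) = σ * (convPow σ 0 b w + divPow b (-(w : ℚ) / 2)) := by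
  obtain ⟨w, rfl⟩ := Nat.exists_eq_add_of_le' hw
  simp only [convPow, divPow_zero]
  rw [Finset.Nat.sum_antidiagonal_succ (N := ℚ) (n := w + 1),
    Finset.Nat.sum_antidiagonal_succ (N := ℚ) (n := w)]
  simp only [lt_irrefl, false_and, if_false, Nat.succ_pos, true_and, zero_add]
  rw [Finset.Nat.sum_antidiagonal_succ (N := ℚ) (n := w)]
  simp only [lt_irrefl, false_and, Nat.succ_pos, true_and, if_true, if_false, mul_add,
    Finset.mul_sum, zero_add, pow_one, mul_one]
  rw [add_comm]
  congr 1
  refine Finset.sum_congr rfl fun p _ => ?_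
  split_ifs <;> ring

/-- Since -w/2 = -u/2 - v/2, the factor raises one of the two divided powers. This gives the
recursion in a. -/
theorem convPow_mul (σ : ℚ) (a b w : ℕ) :
    -(w : ℚ) / 2 * convPow σ a b w
      = (a + 1) * convPow σ (a + 1) b w + (b + 1) * convPow σ a (b + 1) w := by
  simp only [convPow, Finset.mul_sum, ← Finset.sum_add_distrib]
  refine Finset.sum_congr rfl ?_
  rintro ⟨u, v⟩ h
  rw [mem_antidiagonal] at h
  simp only at h ⊢
  subst h
  split_ifs
  · have h1 := mul_divPow a (-(u : ℚ) / 2)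
    have h2 := mul_divPow b (-(v : ℚ) / 2)
    push_cast
    linear_combination σ ^ u * divPow b (-(v : ℚ) / 2) * h1
      + σ ^ u * divPow a (-(u : ℚ) / 2) * h2
  · simp

/-- The Euler-Maclaurin (or Euler-Boole) summation for the terms of `convPow`, from the
corresponding difference equation. -/
theorem convPow_eq (σ κ : ℚ) (B : ℕ → ℚ)
    (hB : ∀ b, B b * (1 + (-1) ^ b) = -if b = 0 then 1 else 0)
    (hE : ∀ b x, κ * divPow (b + 1) (x - 1 / 2)
        + ∑ p ∈ antidiagonal b, B p.1 * divPow p.2 (x - 1 / 2)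
      = σ * (κ * divPow (b + 1) x + ∑ p ∈ antidiagonal b, B p.1 * divPow p.2 x + divPow b x))
    (a b w : ℕ) (hw : 0 < w) :
    convPow σ a b w = ∑ p ∈ antidiagonal (a + b), B p.1 * divPow p.2 (-(w : ℚ) / 2)
        * ((-1) ^ b * p.1.choose b * σ ^ w + (-1) ^ a * p.1.choose a)
      + κ * divPow (a + b + 1) (-(w : ℚ) / 2) := by
  induction a generalizing b with
  | zero =>
    -- For a = 0 the coefficient p.1.choose b with p.1 ≤ b only survives at p = (b, 0).
    have key : ∀ w : ℕ, ∑ p ∈ antidiagonal (0 + b), B p.1 * divPow p.2 (-(w : ℚ) / 2)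
        * ((-1) ^ b * p.1.choose b * σ ^ w + (-1) ^ 0 * p.1.choose 0)
      = ∑ p ∈ antidiagonal b, B p.1 * divPow p.2 (-(w : ℚ) / 2) + (-1) ^ b * B b * σ ^ w := by
      intro w
      rw [zero_add]
      simp only [mul_add, Finset.sum_add_distrib, pow_zero, Nat.choose_zero_right, Nat.cast_one,
        mul_one]
      rw [add_comm]
      congr 1
      rw [Finset.sum_eq_single (b, 0)]
      · simp [divPow_zero]
        ring
      · rintro ⟨i, j⟩ h hne
        rw [mem_antidiagonal] at h
        have : i < b := by
          rcases Nat.eq_zero_or_pos j with rfl | hj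
          · simp at h; simp [h] at hne
          · simp at h; omega
        simp [Nat.choose_eq_zero_of_lt this]
      · simp
    rw [key]
    induction w, hw using Nat.le_induction with
    | base =>
      -- At w = 1 the convolution is empty. The difference equation at x = 0 gives the value at
      -- -1/2, and `hB` makes the total vanish.
      have h0 := hE b 0
      have h1 := hB b
      have hs : ∑ p ∈ antidiagonal b, B p.1 * divPow p.2 0 = B b := by
        rw [Finset.sum_eq_single (b, 0)]
        · simp [divPow_zero]
        · rintro ⟨i, j⟩ h hne
          have : j ≠ 0 := by
            rintro rfl
            simp at h
            simp [h] at hne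
          simp [divPow_at_zero, this]
        · simp
      rw [hs] at h0
      have hc : convPow σ 0 b (0 + 1) = 0 := by
        rw [convPow, Finset.Nat.sum_antidiagonal_succ]
        simp
      rw [hc]
      simp only [divPow_at_zero, Nat.succ_ne_zero, if_false] at h0
      norm_num at h0 ⊢
      linear_combination (-1) * h0 + (-σ) * h1
    | succ w hw ih =>
      rw [convPow_zero_succ σ b w hw, ih]
      have := hE b (-(w : ℚ) / 2)
      rw [show -((w + 1 : ℕ) : ℚ) / 2 = -(w : ℚ) / 2 - 1 / 2 by push_cast; ring, zero_add]
      rw [pow_succ]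
      linear_combination -this
  | succ a ih =>
    have h1 := convPow_mul σ a b w
    have ha : (a + 1 : ℚ) ≠ 0 := by positivity
    refine mul_left_cancel₀ ha ?_
    -- The product rule is solved for the term with a + 1; the other two terms are known by
    -- induction, for b and b + 1.
    rw [eq_sub_of_add_eq h1.symm, ih b, ih (b + 1), mul_add, mul_add, mul_add]
    have h2 : -(w : ℚ) / 2 * ∑ p ∈ antidiagonal (a + b), B p.1 * divPow p.2 (-(w : ℚ) / 2)
        * ((-1) ^ b * p.1.choose b * σ ^ w + (-1) ^ a * p.1.choose a)
      = ∑ p ∈ antidiagonal (a + b + 1), p.2 * (B p.1 * divPow p.2 (-(w : ℚ) / 2)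
        * ((-1) ^ b * p.1.choose b * σ ^ w + (-1) ^ a * p.1.choose a)) := by
      -- Raising the divided power shifts p.2 by one; the new end term p.2 = 0 carries the factor 0.
      rw [Finset.Nat.sum_antidiagonal_succ', Finset.mul_sum]
      simp only [Nat.cast_zero, zero_mul, zero_add]
      refine Finset.sum_congr rfl fun p _ => ?_
      have := mul_divPow p.2 (-(w : ℚ) / 2)
      push_cast
      linear_combination B p.1 * ((-1) ^ b * p.1.choose b * σ ^ w + (-1) ^ a * p.1.choose a) * this
    rw [h2, show a + 1 + b = a + b + 1 by ring, show a + (b + 1) = a + b + 1 by ring]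
    have h3 : ∑ p ∈ antidiagonal (a + b + 1), p.2 * (B p.1 * divPow p.2 (-(w : ℚ) / 2)
        * ((-1) ^ b * p.1.choose b * σ ^ w + (-1) ^ a * p.1.choose a))
      - (b + 1) * ∑ p ∈ antidiagonal (a + b + 1), B p.1 * divPow p.2 (-(w : ℚ) / 2)
        * ((-1) ^ (b + 1) * p.1.choose (b + 1) * σ ^ w + (-1) ^ a * p.1.choose a)
      = (a + 1) * ∑ p ∈ antidiagonal (a + b + 1), B p.1 * divPow p.2 (-(w : ℚ) / 2)
        * ((-1) ^ b * p.1.choose b * σ ^ w + (-1) ^ (a + 1) * p.1.choose (a + 1)) := by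
      rw [Finset.mul_sum, Finset.mul_sum, ← Finset.sum_sub_distrib]
      refine Finset.sum_congr rfl ?_
      rintro ⟨i, j⟩ h
      rw [mem_antidiagonal] at h
      simp only at h ⊢
      have hj : (i : ℚ) + j = a + b + 1 := by exact_mod_cast h
      have hja := cast_choose_succ_mul i a
      have hjb := cast_choose_succ_mul i b
      rw [pow_succ, pow_succ]
      have hj' : (j : ℚ) = a + b + 1 - i := by linarith
      rw [hj']
      linear_combination B i * divPow j (-(w : ℚ) / 2) * ((-1) ^ b * σ ^ w) * hjb
        + B i * divPow j (-(w : ℚ) / 2) * (-1) ^ a * hja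
    have h4 := mul_divPow (a + b + 1) (-(w : ℚ) / 2)
    push_cast at h4
    linear_combination h3 + κ * h4

/-! ### Generating functions of the constants β -/

/-- The exponential series `e^{xt}`. -/
def expSeries (x : ℚ) : PowerSeries ℚ := PowerSeries.mk fun n => divPow n x

theorem expSeries_add (x y : ℚ) : expSeries (x + y) = expSeries x * expSeries y := by
  ext n
  simp [expSeries, PowerSeries.coeff_mul, divPow_add]

theorem rescale_exp (x : ℚ) : PowerSeries.rescale x (PowerSeries.exp ℚ) = expSeries x := by
  ext n
  simp [expSeries, PowerSeries.coeff_rescale, PowerSeries.coeff_exp, divPow, div_eq_mul_inv]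

theorem rescale_bernoulli_mul (x : ℚ) :
    PowerSeries.rescale x (bernoulliPowerSeries ℚ) * (expSeries x - 1)
      = PowerSeries.C x * PowerSeries.X := by
  have := congrArg (PowerSeries.rescale x) (bernoulliPowerSeries_mul_exp_sub_one ℚ)
  rw [map_mul, map_sub, map_one, rescale_exp] at this
  rw [this]
  ext n
  rw [PowerSeries.coeff_rescale, PowerSeries.coeff_C_mul, PowerSeries.coeff_X]
  split_ifs with h <;> simp [h]

/-- The numbers `4 (-1)^p β^e_p`. -/
def eulerE (p : ℕ) : ℚ := 4 * (-1) ^ p * betaE p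

/-- The numbers `4 (-1)^p β^o_p`. -/
def eulerO (p : ℕ) : ℚ := 4 * (-1) ^ p * betaO p

/-- The generating function is -2 times the Bernoulli series at -t/2, that is t/(e^{-t/2} - 1). -/
theorem eulerE_series_mul :
    PowerSeries.mk eulerE * (expSeries (-1 / 2) - 1) = PowerSeries.X := by
  have h : PowerSeries.mk eulerE
      = PowerSeries.C (-2) * PowerSeries.rescale (-1 / 2) (bernoulliPowerSeries ℚ) := by
    ext n
    simp only [eulerE, betaE, PowerSeries.coeff_mk, PowerSeries.coeff_C_mul,
      PowerSeries.coeff_rescale, bernoulliPowerSeries, div_pow, pow_succ]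
    simp
    field_simp
    ring
  rw [h, mul_assoc, rescale_bernoulli_mul, ← mul_assoc, ← map_mul]
  norm_num

/-- The generating function is -1/(e^{-t/2} + 1), which comes from the Bernoulli series at -t and
-t/2 through 1/(y + 1) = 1/(y - 1) - 2/(y² - 1). As `eulerO 0` is 0, the index shift is a division
by t. -/
theorem eulerO_series_mul :
    PowerSeries.mk (fun i => eulerO (i + 1)) * (expSeries (-1 / 2) + 1) = -1 := by
  have h : PowerSeries.X * PowerSeries.mk (fun i => eulerO (i + 1))
      = PowerSeries.C (-2) * (PowerSeries.rescale (-1) (bernoulliPowerSeries ℚ)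
        - PowerSeries.rescale (-1 / 2) (bernoulliPowerSeries ℚ)) := by
    ext n
    rw [PowerSeries.coeff_C_mul, map_sub, PowerSeries.coeff_rescale, PowerSeries.coeff_rescale]
    cases n with
    | zero => simp
    | succ n =>
      rw [PowerSeries.coeff_succ_X_mul]
      simp only [eulerO, betaO, PowerSeries.coeff_mk, bernoulliPowerSeries, div_pow]
      simp
      field_simp
      ring
  have h1 := rescale_bernoulli_mul (-1)
  have h2 := rescale_bernoulli_mul (-1 / 2)
  -- This is e^{-t} = (e^{-t/2})², so that both Bernoulli series share the denominator y² - 1.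
  rw [show (-1 : ℚ) = -1 / 2 + -1 / 2 by norm_num, expSeries_add,
    show (-1 / 2 + -1 / 2 : ℚ) = -1 by norm_num] at h1
  have hX : (PowerSeries.X : PowerSeries ℚ) ≠ 0 := PowerSeries.X_ne_zero
  have hne : expSeries (-1 / 2) - 1 ≠ 0 := by
    intro h0
    have := congrArg (PowerSeries.coeff 1) h0
    simp [expSeries, divPow, PowerSeries.coeff_one] at this
  refine mul_left_cancel₀ (mul_ne_zero hX hne) ?_
  have c1 : (PowerSeries.C (-2 : ℚ)) * PowerSeries.C (-1) = 2 := by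
    rw [← map_mul, show (-2 * -1 : ℚ) = 2 by norm_num, map_ofNat]
  have c2 : (PowerSeries.C (-2 : ℚ)) * PowerSeries.C (-1 / 2) = 1 := by
    rw [← map_mul]; norm_num
  linear_combination (expSeries (-1 / 2) - 1) * (expSeries (-1 / 2) + 1) * h
    + PowerSeries.C (-2) * h1 - PowerSeries.C (-2) * (expSeries (-1 / 2) + 1) * h2
    + PowerSeries.X * c1 - PowerSeries.X * (expSeries (-1 / 2) + 1) * c2

theorem bernoulli_add_one_of_even {b : ℕ} (hb : b ≠ 0) (h : Even b) : bernoulli (b + 1) = 0 :=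
  bernoulli_eq_zero_of_odd h.add_one (by omega)

/-- For odd b the bracket vanishes, for even b > 0 the Bernoulli number does; b = 0 carries B_1. -/
theorem eulerE_succ_mul (b : ℕ) :
    eulerE (b + 1) * (1 + (-1) ^ b) = -if b = 0 then 1 else 0 := by
  rcases eq_or_ne b 0 with rfl | hb
  · norm_num [eulerE, betaE]
  · rcases Nat.even_or_odd b with h | h
    · simp [eulerE, betaE, bernoulli_add_one_of_even hb h, hb]
    · simp [h.neg_one_pow, hb]

theorem eulerO_succ_mul (b : ℕ) :
    eulerO (b + 1) * (1 + (-1) ^ b) = -if b = 0 then 1 else 0 := by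
  rcases eq_or_ne b 0 with rfl | hb
  · norm_num [eulerO, betaO]
  · rcases Nat.even_or_odd b with h | h
    · simp [eulerO, betaO, bernoulli_add_one_of_even hb h, hb]
    · simp [h.neg_one_pow, hb]

/-- Boole's formula: with alternating signs there is no integral term, so κ = 0. -/
theorem convPow_neg_one (a b w : ℕ) (hw : 0 < w) :
    convPow (-1) a b w = ∑ p ∈ antidiagonal (a + b),
      eulerO (p.1 + 1) * divPow p.2 (-(w : ℚ) / 2)
        * ((-1) ^ b * p.1.choose b * (-1) ^ w + (-1) ^ a * p.1.choose a) := by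
  rw [convPow_eq (-1) 0 (fun i => eulerO (i + 1)) eulerO_succ_mul _ a b w hw,
    zero_mul, add_zero]
  intro b x
  have h : PowerSeries.mk (fun i => eulerO (i + 1)) * expSeries (x - 1 / 2)
      = -(PowerSeries.mk (fun i => eulerO (i + 1)) * expSeries x + expSeries x) := by
    rw [show x - 1 / 2 = x + -1 / 2 by ring, expSeries_add]
    linear_combination expSeries x * eulerO_series_mul
  have := congrArg (PowerSeries.coeff b) h
  simp only [PowerSeries.coeff_mul, map_neg, map_add, expSeries, PowerSeries.coeff_mk] at this
  rw [this]
  ring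

/-- Here κ = `eulerE 0` = -2 is the integral term of Euler–Maclaurin. -/
theorem convPow_one (a b w : ℕ) (hw : 0 < w) :
    convPow 1 a b w = ∑ p ∈ antidiagonal (a + b),
      eulerE (p.1 + 1) * divPow p.2 (-(w : ℚ) / 2)
        * ((-1) ^ b * p.1.choose b + (-1) ^ a * p.1.choose a)
      - 2 * divPow (a + b + 1) (-(w : ℚ) / 2) := by
  rw [convPow_eq 1 (-2) (fun i => eulerE (i + 1)) eulerE_succ_mul _ a b w hw]
  · simp only [one_pow, mul_one]
    ring
  intro b x
  have h : PowerSeries.mk eulerE * expSeries (x - 1 / 2)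
      = PowerSeries.mk eulerE * expSeries x + PowerSeries.X * expSeries x := by
    rw [show x - 1 / 2 = x + -1 / 2 by ring, expSeries_add]
    linear_combination expSeries x * eulerE_series_mul
  have := congrArg (PowerSeries.coeff (b + 1)) h
  rw [map_add, PowerSeries.coeff_succ_X_mul] at this
  simp only [PowerSeries.coeff_mul, expSeries, PowerSeries.coeff_mk,
    Finset.Nat.sum_antidiagonal_succ] at this
  have h0 : eulerE 0 = -2 := by norm_num [eulerE, betaE]
  rw [h0] at this
  rw [this]
  ring

/-! ### Stuffle product of the rational q-series -/

theorem sum_posPairs {M : Type*} [AddCommMonoid M] (n : ℕ) (f : ℕ × ℕ → M) :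
    ∑ x ∈ posPairs (n + 2), f x = ∑ x ∈ antidiagonal n, f (x.1 + 1, x.2 + 1) := by
  symm
  refine Finset.sum_nbij' (fun x => (x.1 + 1, x.2 + 1)) (fun x => (x.1 - 1, x.2 - 1)) ?_ ?_ ?_ ?_ ?_
  · rintro ⟨i, j⟩ h
    rw [mem_antidiagonal] at h
    simp only [posPairs, mem_filter, mem_antidiagonal] at h ⊢
    omega
  · rintro ⟨i, j⟩ h
    simp only [posPairs, mem_filter, mem_antidiagonal] at h ⊢
    omega
  · rintro ⟨i, j⟩ h
    rfl
  · rintro ⟨i, j⟩ h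
    simp only [posPairs, mem_filter, mem_antidiagonal] at h
    ext <;> simp <;> omega
  · rintro _ _
    rfl

theorem g_stuffle (a b : Par) (r s : ℕ) : g a r * g b s = gg a b r s + gg b a s r
    + dsum fun w _ => ∑ p ∈ antidiagonal w,
      if 0 < p.1 ∧ 0 < p.2 then phiCoeff a r p.1 * phiCoeff b s p.2 else 0 := by
  rw [g_mul_g, qsum_stuffle, gg_eq_qsum, gg_eq_qsum]
  simp only [mul_comm]

/-- Only one factor carries a sign, so the diagonal is the convolution with σ = -1. The terms
containing (-1)^w form the series g^o, the others g^e. -/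
theorem g_od_ev_stuffle (a b : ℕ) : g .od (a + 1) * g .ev (b + 1)
    = gg .od .ev (a + 1) (b + 1) + gg .ev .od (b + 1) (a + 1)
      + ∑ p ∈ antidiagonal (a + b), ((-(1 / 2) * eulerO (p.1 + 1) * ((-1) ^ b * p.1.choose b))
          • g .od (p.2 + 1)
        + (-(1 / 2) * eulerO (p.1 + 1) * ((-1) ^ a * p.1.choose a)) • g .ev (p.2 + 1)) := by
  rw [g_stuffle]
  congr 1
  simp only [g_eq_dsum, ← map_smul, ← map_add, ← map_sum]
  refine dsum_congr fun w _ hw _ => ?_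
  have h := convPow_neg_one a b w hw
  have h1 : ∑ p ∈ antidiagonal w, (if 0 < p.1 ∧ 0 < p.2 then
      phiCoeff .od (a + 1) p.1 * phiCoeff .ev (b + 1) p.2 else 0)
        = 1 / 4 * convPow (-1) a b w := by
    rw [convPow, Finset.mul_sum]
    refine Finset.sum_congr rfl fun p _ => ?_
    split_ifs
    · rw [phiCoeff_succ, phiCoeff_succ]
      simp only [Par.sgn]
      ring
    · simp
  rw [h1, h, Finset.mul_sum, Finset.sum_apply, Finset.sum_apply]
  refine Finset.sum_congr rfl fun p _ => ?_
  simp only [Pi.add_apply, Pi.smul_apply, smul_eq_mul, phiCoeff_succ, Par.sgn]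
  ring

/-- Here (-1)^u (-1)^v = (-1)^w factors out of the diagonal, which leaves σ = 1. -/
theorem g_od_od_stuffle (a b : ℕ) : g .od (a + 1) * g .od (b + 1)
    = gg .od .od (a + 1) (b + 1) + gg .od .od (b + 1) (a + 1)
      + (∑ p ∈ antidiagonal (a + b), (-(1 / 2) * eulerE (p.1 + 1)
          * ((-1) ^ b * p.1.choose b + (-1) ^ a * p.1.choose a)) • g .od (p.2 + 1)
        + g .od (a + b + 2)) := by
  rw [g_stuffle]
  congr 1
  simp only [g_eq_dsum, ← map_smul, ← map_add, ← map_sum]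
  refine dsum_congr fun w _ hw _ => ?_
  have h := convPow_one a b w hw
  have h1 : ∑ p ∈ antidiagonal w, (if 0 < p.1 ∧ 0 < p.2 then
      phiCoeff .od (a + 1) p.1 * phiCoeff .od (b + 1) p.2 else 0)
        = 1 / 4 * (-1) ^ w * convPow 1 a b w := by
    rw [convPow, Finset.mul_sum]
    refine Finset.sum_congr rfl ?_
    rintro ⟨u, v⟩ h
    rw [mem_antidiagonal] at h
    subst h
    simp only
    split_ifs
    · rw [phiCoeff_succ, phiCoeff_succ]
      simp only [Par.sgn, one_pow, pow_add]
      ring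
    · simp
  rw [h1, h, mul_sub, Finset.mul_sum, Pi.add_apply, Pi.add_apply, Finset.sum_apply,
    Finset.sum_apply, sub_eq_add_neg]
  congr 1
  · refine Finset.sum_congr rfl fun p _ => ?_
    simp only [Pi.smul_apply, smul_eq_mul, phiCoeff_succ, Par.sgn]
    ring
  -- The integral term becomes g^o_{a+b+2}: 1/4 · (-2) is the constant -1/2 of φ.
  · rw [phiCoeff_succ]
    simp only [Par.sgn]
    ring

/-- With p = i + 1 the left side is -2(-1)^p β_p. For odd p it vanishes unless p = 1, where it is
2β_1 = 1/4. -/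
theorem neg_half_mul_eulerO (i : ℕ) : -(1 / 2) * eulerO (i + 1)
    = -((1 + (-1) ^ (i + 1)) * betaO (i + 1)) + if i = 0 then 1 / 4 else 0 := by
  have h := eulerO_succ_mul i
  unfold eulerO at *
  rcases Nat.even_or_odd i with hi | hi
  · rw [hi.neg_one_pow, hi.add_one.neg_one_pow] at *
    split_ifs at h ⊢ <;> linarith
  · have h0 : i ≠ 0 := by rintro rfl; simp at hi
    rw [hi.add_one.neg_one_pow, if_neg h0]
    ring

theorem neg_half_mul_eulerE (i : ℕ) : -(1 / 2) * eulerE (i + 1)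
    = -((1 + (-1) ^ (i + 1)) * betaE (i + 1)) + if i = 0 then 1 / 4 else 0 := by
  have h := eulerE_succ_mul i
  unfold eulerE at *
  rcases Nat.even_or_odd i with hi | hi
  · rw [hi.neg_one_pow, hi.add_one.neg_one_pow] at *
    split_ifs at h ⊢ <;> linarith
  · have h0 : i ≠ 0 := by rintro rfl; simp at hi
    rw [hi.add_one.neg_one_pow, if_neg h0]
    ring

/-! ### Shuffle product of the rational q-series -/

theorem sgn_add (a : Par) (u v : ℕ) : a.sgn (u + v) = a.sgn u * a.sgn v := by
  cases a <;> simp [Par.sgn, pow_add]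

/-- The shuffle replaces (u, v) by (u + v, u) or (u, u + v). Signs are multiplicative, so the
variable u collects both signs, whence `c`, and v keeps that of the factor containing u + v. The
diagonal weight m - 1 produces ḡ + g. -/
theorem g_shuffle (a b c : Par) (hc : ∀ u, c.sgn u = a.sgn u * b.sgn u) (r s : ℕ) :
    g a (r + 1) * g b (s + 1) = ∑ p ∈ antidiagonal (r + s),
        ((p.1.choose r : ℚ) • gg c b (p.1 + 1) (p.2 + 1)
          + (p.1.choose s : ℚ) • gg c a (p.1 + 1) (p.2 + 1))
      + (1 / 2 * (r + s).choose r : ℚ) • (gbar c (r + s) + g c (r + s + 1)) := by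
  rw [g_mul_g, qsum_shuffle (fun u v => phiCoeff a (r + 1) u * phiCoeff b (s + 1) v), add_comm
    (qsum _)]
  congr 1
  · rw [Finset.sum_add_distrib]
    simp only [gg_eq_qsum, ← map_smul, ← map_sum]
    congr 1
    · refine qsum_congr fun u m v m' _ _ _ _ => ?_
      simp only [Finset.sum_apply, Pi.smul_apply, smul_eq_mul]
      split_ifs
      · simp only [phiCoeff_succ, hc, sgn_add]
        have := sum_choose_mul_divPow r s (-(u : ℚ) / 2) (-(v : ℚ) / 2)
        rw [show -((u + v : ℕ) : ℚ) / 2 = -(u : ℚ) / 2 + -(v : ℚ) / 2 by push_cast; ring]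
        rw [show -(1 / 2) * a.sgn u * divPow r (-(u : ℚ) / 2) *
          (-(1 / 2) * (b.sgn u * b.sgn v) * divPow s (-(u : ℚ) / 2 + -(v : ℚ) / 2))
          = 1 / 4 * a.sgn u * b.sgn u * b.sgn v * (divPow r (-(u : ℚ) / 2)
            * divPow s (-(u : ℚ) / 2 + -(v : ℚ) / 2)) by ring, ← this, Finset.mul_sum]
        refine Finset.sum_congr rfl fun p _ => ?_
        ring
      · simp
    · refine qsum_congr fun u m v m' _ _ _ _ => ?_
      simp only [Finset.sum_apply, Pi.smul_apply, smul_eq_mul]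
      split_ifs
      · simp only [phiCoeff_succ, hc, sgn_add]
        have := sum_choose_mul_divPow s r (-(u : ℚ) / 2) (-(v : ℚ) / 2)
        rw [add_comm s r] at this
        rw [show -((u + v : ℕ) : ℚ) / 2 = -(u : ℚ) / 2 + -(v : ℚ) / 2 by push_cast; ring]
        rw [show -(1 / 2) * (a.sgn u * a.sgn v) * divPow r (-(u : ℚ) / 2 + -(v : ℚ) / 2) *
          (-(1 / 2) * b.sgn u * divPow s (-(u : ℚ) / 2))
          = 1 / 4 * a.sgn u * b.sgn u * a.sgn v * (divPow s (-(u : ℚ) / 2)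
            * divPow r (-(u : ℚ) / 2 + -(v : ℚ) / 2)) by ring, ← this, Finset.mul_sum]
        refine Finset.sum_congr rfl fun p _ => ?_
        ring
      · simp
  · rw [gbar_eq_dsum, g_eq_dsum, ← map_add, ← map_smul]
    refine dsum_congr fun u m _ _ => ?_
    simp only [Pi.smul_apply, Pi.add_apply, smul_eq_mul, phiCoeff_succ, hc]
    have := divPow_mul r s (-(u : ℚ) / 2)
    linear_combination (1 / 4 * ((m : ℚ) - 1) * a.sgn u * b.sgn u) * this

/-! ### The boundary terms ε -/

/-- The Kronecker deltas select the points p.1 = 1, p.1 = 0 and p.2 = 0 of the antidiagonal. The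
shifts in the argument of ḡ make the first two contribute the same series `f N`, and N ≠ 0 excludes
the corner with α. -/
theorem sum_smul_boundary {M : Type*} [AddCommGroup M] [Module ℚ M] (N : ℕ) (hN : N ≠ 0)
    (c : ℕ → ℚ) (f h : ℕ → M) (α : M) :
    ∑ p ∈ antidiagonal N, c p.1 • (kron (p.1 + 1) 2 • f (p.2 + 1) - kron (p.1 + 1) 1 • f p.2
        + kron (p.2 + 1) 1 • h p.1 + (kron (p.1 + 1) 1 * kron (p.2 + 1) 1) • α)
      = (c 1 - c 0) • f N + c N • h N := by
  obtain ⟨N, rfl⟩ := Nat.exists_eq_succ_of_ne_zero hN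
  have e1 : ∑ p ∈ antidiagonal (N + 1), (c p.1 * kron (p.1 + 1) 2) • f (p.2 + 1)
      = c 1 • f (N + 1) := by
    rw [Finset.sum_eq_single (1, N)]
    · simp [kron]
    · rintro ⟨i, j⟩ hp hne
      rw [mem_antidiagonal] at hp
      have : i ≠ 1 := by
        rintro rfl
        simp only at hp
        exact hne (by ext <;> simp; omega)
      simp [kron, this]
    · intro hn
      exact absurd (by rw [mem_antidiagonal]; omega) hn
  have e2 : ∑ p ∈ antidiagonal (N + 1), (c p.1 * kron (p.1 + 1) 1) • f p.2 = c 0 • f (N + 1) := by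
    rw [Finset.sum_eq_single (0, N + 1)]
    · simp [kron]
    · rintro ⟨i, j⟩ hp hne
      rw [mem_antidiagonal] at hp
      have : i ≠ 0 := by
        rintro rfl
        simp only at hp
        exact hne (by ext <;> simp; omega)
      simp [kron, this]
    · intro hn
      exact absurd (by rw [mem_antidiagonal]; omega) hn
  have e3 : ∑ p ∈ antidiagonal (N + 1), (c p.1 * kron (p.2 + 1) 1) • h p.1
      = c (N + 1) • h (N + 1) := by
    rw [Finset.sum_eq_single (N + 1, 0)]
    · simp [kron]
    · rintro ⟨i, j⟩ hp hne
      rw [mem_antidiagonal] at hp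
      have : j ≠ 0 := by
        rintro rfl
        simp only at hp
        exact hne (by ext <;> simp; omega)
      simp [kron, this]
    · intro hn
      exact absurd (by simp) hn
  rw [sub_smul, ← e1, ← e2, ← e3, ← Finset.sum_sub_distrib, ← Finset.sum_add_distrib]
  refine Finset.sum_congr rfl ?_
  rintro ⟨i, j⟩ hp
  rw [mem_antidiagonal] at hp
  have h0 : kron (i + 1) 1 * kron (j + 1) 1 = 0 := by
    simp only [kron]
    split_ifs with h1 h2 <;> simp
    simp at hp
    omega
  simp only [h0, zero_smul, add_zero, smul_add, smul_sub, smul_smul]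

theorem choose_one_sub_choose_zero (a : ℕ) :
    ((Nat.choose 1 a : ℚ) - Nat.choose 0 a) = kron (a + 1) 2 := by
  rcases a with _ | _ | a <;> simp [kron, Nat.choose_eq_zero_of_lt]

theorem kron_two_smul {M : Type*} [AddCommGroup M] [Module ℚ M] (a b : ℕ) (f : ℕ → M) :
    kron (a + 1) 2 • f (a + b) = kron (a + 1) 2 • f (b + 1) := by
  by_cases h : a = 1
  · rw [h, add_comm 1 b]
  · simp [kron, h]

/-- After division by 4 the last term is the diagonal contribution of `g_shuffle`, and the deltas at
2 are the correction terms of the theorem. -/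
theorem epsOE_shuffle (a b : ℕ) (h : a + b ≠ 0) :
    ∑ p ∈ antidiagonal (a + b), ((p.1.choose a : ℚ) • epsOE (p.1 + 1) (p.2 + 1)
        + (p.1.choose b : ℚ) • epsOO (p.1 + 1) (p.2 + 1))
      = kron (a + 1) 2 • gbar .ev (b + 1) + kron (b + 1) 2 • gbar .od (a + 1)
        + (2 * (a + b).choose a : ℚ) • (gbar .od (a + b) + g .od (a + b + 1)) := by
  simp only [epsOE, epsOO, Nat.add_sub_cancel]
  rw [Finset.sum_add_distrib,
    sum_smul_boundary (a + b) h (fun i => (i.choose a : ℚ)) (fun j => gbar .ev j)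
      (fun i => gbar .od i + g .od (i + 1)) alphaTwo,
    sum_smul_boundary (a + b) h (fun i => (i.choose b : ℚ)) (fun j => gbar .od j)
      (fun i => gbar .od i + g .od (i + 1)) alphaThree]
  simp only [choose_one_sub_choose_zero]
  rw [kron_two_smul a b (fun j => gbar .ev j), add_comm a b,
    kron_two_smul b a (fun j => gbar .od j), Nat.choose_symm_add, add_comm b a]
  module

theorem epsEO_shuffle (a b : ℕ) (h : a + b ≠ 0) :
    ∑ p ∈ antidiagonal (a + b),
        ((p.1.choose a : ℚ) + p.1.choose b) • epsEO (p.1 + 1) (p.2 + 1)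
      = kron (a + 1) 2 • gbar .od (b + 1) + kron (b + 1) 2 • gbar .od (a + 1)
        + (2 * (a + b).choose a : ℚ) • (gbar .ev (a + b) + g .ev (a + b + 1)) := by
  simp only [epsEO, Nat.add_sub_cancel]
  rw [sum_smul_boundary (a + b) h (fun i => (i.choose a : ℚ) + i.choose b) (fun j => gbar .od j)
      (fun i => gbar .ev i + g .ev (i + 1)) alphaOne]
  have h1 := kron_two_smul a b (fun j => gbar .od j)
  have h2 := kron_two_smul b a (fun j => gbar .od j)
  rw [add_comm b a] at h2
  rw [add_sub_add_comm, choose_one_sub_choose_zero, choose_one_sub_choose_zero, add_smul, h1, h2,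
    Nat.choose_symm_add]
  module

theorem kron_one_mul_kron_one {a b : ℕ} (h : a + b ≠ 0) : kron (a + 1) 1 * kron (b + 1) 1 = 0 := by
  simp only [kron]
  split_ifs with h1 h2 <;> simp
  omega

/-- The ḡ terms with a delta at 1 occur with opposite signs in the two summands; only the g terms
survive there. -/
theorem epsOE_add_epsEO (a b : ℕ) (h : a + b ≠ 0) :
    epsOE (a + 1) (b + 1) + epsEO (b + 1) (a + 1)
      = kron (a + 1) 2 • gbar .ev (b + 1) + kron (b + 1) 2 • gbar .od (a + 1)
        + (kron (b + 1) 1 • g .od (a + 1) + kron (a + 1) 1 • g .ev (b + 1)) := by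
  simp only [epsOE, epsEO, Nat.add_sub_cancel, kron_one_mul_kron_one h,
    kron_one_mul_kron_one (a := b) (b := a) (by omega)]
  module

theorem epsOO_add_epsOO (a b : ℕ) (h : a + b ≠ 0) :
    epsOO (a + 1) (b + 1) + epsOO (b + 1) (a + 1)
      = kron (a + 1) 2 • gbar .od (b + 1) + kron (b + 1) 2 • gbar .od (a + 1)
        + (kron (b + 1) 1 • g .od (a + 1) + kron (a + 1) 1 • g .od (b + 1)) := by
  simp only [epsOO, Nat.add_sub_cancel, kron_one_mul_kron_one h,
    kron_one_mul_kron_one (a := b) (b := a) (by omega)]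
  module

/-! ### Binomial identities for the coefficients of the linear part -/

/-- This is the i-th finite difference of x ↦ binom(x, a) at j: by Pascal's rule each difference
lowers a by one. -/
theorem sum_alternating_choose_mul_choose (i j a : ℕ) :
    ∑ l ∈ range (i + 1), (-1 : ℚ) ^ l * i.choose l * ((i + j - l).choose a : ℚ)
      = if i ≤ a then (j.choose (a - i) : ℚ) else 0 := by
  induction i generalizing a with
  | zero => simp
  | succ i ih =>
    have hstep : ∑ l ∈ range (i + 1 + 1),
        (-1 : ℚ) ^ l * (i + 1).choose l * ((i + 1 + j - l).choose a : ℚ)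
        = ∑ l ∈ range (i + 1), (-1 : ℚ) ^ l * i.choose l
          * (((i + j - l + 1).choose a : ℚ) - (i + j - l).choose a) := by
      have e1 : ∑ l ∈ range (i + 1), (-1 : ℚ) ^ l * i.choose l * ((i + j - l + 1).choose a : ℚ)
          = ∑ l ∈ range (i + 1 + 1),
            (-1 : ℚ) ^ l * i.choose l * ((i + 1 + j - l).choose a : ℚ) := by
        rw [Finset.sum_range_succ _ (i + 1)]
        simp only [Nat.choose_succ_self, Nat.cast_zero, mul_zero, zero_mul, add_zero]
        refine Finset.sum_congr rfl fun l hl => ?_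
        rw [mem_range] at hl
        rw [show i + 1 + j - l = i + j - l + 1 by omega]
      simp only [mul_sub, Finset.sum_sub_distrib]
      rw [e1, Finset.sum_range_succ' _ (i + 1), Finset.sum_range_succ' _ (i + 1)]
      simp only [Nat.choose_succ_succ, Nat.cast_add, mul_add, add_mul, Finset.sum_add_distrib]
      have e2 : ∑ l ∈ range (i + 1), (-1 : ℚ) ^ (l + 1) * i.choose l
            * ((i + 1 + j - (l + 1)).choose a : ℚ)
          = -∑ l ∈ range (i + 1), (-1 : ℚ) ^ l * i.choose l * ((i + j - l).choose a : ℚ) := by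
        rw [← Finset.sum_neg_distrib]
        refine Finset.sum_congr rfl fun l hl => ?_
        rw [show i + 1 + j - (l + 1) = i + j - l by omega, pow_succ]
        ring
      rw [e2]
      simp only [Nat.choose_zero_right]
      ring
    rw [hstep]
    cases a with
    | zero => simp
    | succ a =>
      simp only [Nat.choose_succ_succ, Nat.cast_add, add_sub_cancel_right]
      rw [ih a]
      simp

theorem cfOne_succ (s p : ℕ) : cfOne (s + 1) (p + 1) = -((-1) ^ s * p.choose s) := by
  simp [cfOne, pow_succ]

theorem cfTwo_succ (r p : ℕ) : cfTwo (r + 1) (p + 1) = (-1) ^ (p + r) * p.choose r := by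
  simp [cfTwo, show p + 1 + (r + 1) = p + r + 2 by ring, pow_add]

theorem sum_choose_mul_cfOne (a b i j : ℕ) (h : i + j = a + b) :
    ∑ p ∈ antidiagonal (a + b), (p.1.choose a : ℚ) * cfOne (p.2 + 1) (i + 1)
      = -(j.choose b : ℚ) := by
  have key := sum_alternating_choose_mul_choose i j a
  rw [← Finset.Nat.sum_antidiagonal_swap, Finset.Nat.sum_antidiagonal_eq_sum_range_succ_mk]
  simp only [Prod.fst_swap, Prod.snd_swap, cfOne_succ]
  have hsub : ∑ l ∈ range (i + 1), (-1 : ℚ) ^ l * i.choose l * ((i + j - l).choose a : ℚ)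
      = ∑ l ∈ range (a + b + 1), (-1 : ℚ) ^ l * i.choose l * ((a + b - l).choose a : ℚ) := by
    rw [h]
    refine Finset.sum_subset (Finset.range_mono (by omega)) fun l _ hl => ?_
    rw [mem_range, not_lt] at hl
    simp [Nat.choose_eq_zero_of_lt hl]
  rw [hsub] at key
  have hr : (if i ≤ a then (j.choose (a - i) : ℚ) else 0) = j.choose b := by
    split_ifs with hi
    · rw [← Nat.choose_symm_of_eq_add (show j = b + (a - i) by omega)]
    · rw [Nat.choose_eq_zero_of_lt (by omega), Nat.cast_zero]
  rw [hr] at key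
  rw [← key, ← Finset.sum_neg_distrib]
  refine Finset.sum_congr rfl fun l _ => ?_
  ring

/-- The finite difference at j = 0, read backwards: binom(0, a - i) is a Kronecker delta. -/
theorem sum_choose_mul_cfTwo (a b i : ℕ) (h : i ≤ a + b) :
    ∑ p ∈ antidiagonal (a + b), (p.1.choose a : ℚ) * cfTwo (p.1 + 1) (i + 1)
      = kron (i + 1) (a + 1) := by
  have key := sum_alternating_choose_mul_choose i 0 a
  rw [Finset.Nat.sum_antidiagonal_eq_sum_range_succ_mk]
  simp only [cfTwo_succ]
  have hsub : ∑ l ∈ range (i + 1), (l.choose a : ℚ) * ((-1) ^ (i + l) * i.choose l)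
      = ∑ l ∈ range (a + b + 1), (l.choose a : ℚ) * ((-1) ^ (i + l) * i.choose l) := by
    refine Finset.sum_subset (Finset.range_mono (by omega)) fun l _ hl => ?_
    rw [mem_range, not_lt] at hl
    simp [Nat.choose_eq_zero_of_lt hl]
  rw [← hsub, ← Finset.sum_range_reflect]
  have hr : (if i ≤ a then (Nat.choose 0 (a - i) : ℚ) else 0) = kron (i + 1) (a + 1) := by
    simp only [kron, add_left_inj]
    split_ifs with h1 h2 h2
    · simp [h2]
    · rw [Nat.choose_eq_zero_of_lt (by omega), Nat.cast_zero]
    · omega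
    · rfl
  rw [← hr, ← key]
  refine Finset.sum_congr rfl fun l hl => ?_
  rw [mem_range] at hl
  obtain ⟨m, rfl⟩ := Nat.exists_eq_add_of_le (show l ≤ i by omega)
  rw [show l + m + 1 - 1 - l = m by omega, show l + m + 0 - l = m by omega,
    Nat.choose_symm_add, show l + m + m = l + 2 * m by ring, pow_add, pow_mul]
  norm_num
  ring

/-! ### Zeta and double zeta series of level 2 -/

/-- The indicator function of the positive integers of a given parity. -/
def ind (a : Par) (n : ℕ) : ℝ := if 0 < n ∧ n % 2 = a.res then 1 else 0

theorem ind_nonneg (a : Par) (n : ℕ) : 0 ≤ ind a n := by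
  unfold ind; split_ifs <;> norm_num

theorem ind_le_one (a : Par) (n : ℕ) : ind a n ≤ 1 := by
  unfold ind; split_ifs <;> norm_num

theorem ind_zero (a : Par) : ind a 0 = 0 := by simp [ind]

theorem ind_mul_self (a : Par) (n : ℕ) : ind a n * ind a n = ind a n := by
  unfold ind; split_ifs <;> norm_num

theorem hasSum_of_forall_eq {ι : Type*} {f g : ι → ℝ} {v : ℝ} (h : ∀ x, f x = g x)
    (hg : HasSum g v) : HasSum f v := by
  rwa [funext h]

theorem hasSum_zetaSeries (a : Par) {k : ℕ} (hk : 2 ≤ k) :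
    HasSum (fun n : ℕ => ind a n / (n : ℝ) ^ k) (zetaSeries a k) := by
  have h : (fun n : ℕ => if 0 < n ∧ n % 2 = a.res then 1 / (n : ℝ) ^ k else 0)
      = fun n : ℕ => ind a n / (n : ℝ) ^ k := by
    ext n
    unfold ind
    split_ifs <;> simp
  rw [zetaSeries, h]
  refine Summable.hasSum ?_
  refine Summable.of_nonneg_of_le (fun n => div_nonneg (ind_nonneg a n) (by positivity))
    (fun n => ?_) (Real.summable_one_div_nat_pow.2 (show 1 < k by omega))
  exact div_le_div_of_nonneg_right (ind_le_one a n) (by positivity)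

/-- The summand of `dzetaSeries`. -/
def dzetaTerm (a b : Par) (r s : ℕ) (x : ℕ × ℕ) : ℝ :=
  if x.2 < x.1 then ind a x.1 * ind b x.2 / ((x.1 : ℝ) ^ r * (x.2 : ℝ) ^ s) else 0

theorem dzetaTerm_nonneg (a b : Par) (r s : ℕ) (x : ℕ × ℕ) : 0 ≤ dzetaTerm a b r s x := by
  unfold dzetaTerm
  split_ifs
  · exact div_nonneg (mul_nonneg (ind_nonneg _ _) (ind_nonneg _ _)) (by positivity)
  · rfl

theorem dzetaSeries_eq (a b : Par) (r s : ℕ) :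
    dzetaSeries a b r s = ∑' x, dzetaTerm a b r s x := by
  refine tsum_congr ?_
  rintro ⟨m, n⟩
  simp only [dzetaTerm, ind]
  by_cases h1 : n < m
  · have hm : 0 < m := by omega
    by_cases h2 : 0 < n <;> by_cases h3 : m % 2 = a.res <;> by_cases h4 : n % 2 = b.res <;>
      simp [h1, h2, h3, h4, hm]
  · simp [h1]

theorem summable_inv_mul_sqrt : Summable fun n : ℕ => 1 / ((n : ℝ) * √n) := by
  have h := Real.summable_one_div_nat_rpow.2 (show (1 : ℝ) < 3 / 2 by norm_num)
  refine h.congr fun n => ?_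
  rcases Nat.eq_zero_or_pos n with rfl | hn
  · simp
  · have hn' : (0 : ℝ) < n := by exact_mod_cast hn
    rw [show (3 / 2 : ℝ) = 1 + 1 / 2 by norm_num, Real.rpow_add hn', Real.rpow_one,
      Real.sqrt_eq_rpow]

/-- For m > n > 0 one has m^r n^s ≥ m² n ≥ m^{3/2} n^{3/2}, so a product of two convergent series
dominates. -/
theorem hasSum_dzetaSeries (a b : Par) {r s : ℕ} (hr : 2 ≤ r) (hs : 1 ≤ s) :
    HasSum (dzetaTerm a b r s) (dzetaSeries a b r s) := by
  rw [dzetaSeries_eq]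
  refine Summable.hasSum ?_
  refine Summable.of_nonneg_of_le (dzetaTerm_nonneg a b r s) ?_
    (summable_inv_mul_sqrt.mul_of_nonneg summable_inv_mul_sqrt (fun n => by positivity)
      (fun n => by positivity))
  rintro ⟨m, n⟩
  simp only [dzetaTerm]
  split_ifs with h
  · rcases Nat.eq_zero_or_pos n with rfl | hn
    · simp [ind_zero]
    have hn1 : (1 : ℝ) ≤ n := by exact_mod_cast hn
    have hm1 : (1 : ℝ) ≤ m := by exact_mod_cast (by omega : 1 ≤ m)
    have hmn : √(n : ℝ) ≤ √m := Real.sqrt_le_sqrt (by exact_mod_cast h.le)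
    have hn2 : 0 < √(n : ℝ) := Real.sqrt_pos.2 (by linarith)
    have hm2 : 0 < √(m : ℝ) := Real.sqrt_pos.2 (by linarith)
    rw [one_div_mul_one_div]
    have key : (m : ℝ) * √m * (n * √n) ≤ (m : ℝ) ^ r * (n : ℝ) ^ s := by
      calc (m : ℝ) * √m * (n * √n) = m * n * (√m * √n) := by ring
        _ ≤ m * n * (√m * √m) := by gcongr
        _ = (m : ℝ) ^ 2 * (n : ℝ) ^ 1 := by
          rw [Real.mul_self_sqrt (by linarith)]; ring
        _ ≤ (m : ℝ) ^ r * (n : ℝ) ^ s := by gcongr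
    refine div_le_div₀ zero_le_one ?_ (by positivity) key
    exact mul_le_one₀ (ind_le_one _ _) (ind_nonneg _ _) (ind_le_one _ _)
  · positivity

/-- Reindexing by the difference of the two variables: parities add, which turns `a` into `c`. -/
theorem hasSum_dzetaSeries_add {a b c : Par} (hc : (a.res + b.res) % 2 = c.res) {r s : ℕ}
    (hr : 2 ≤ r) (hs : 1 ≤ s) :
    HasSum (fun x : ℕ × ℕ => ind a x.1 * ind b x.2
      * (1 / (((x.1 : ℝ) + x.2) ^ r * (x.2 : ℝ) ^ s))) (dzetaSeries c b r s) := by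
  have hinj : Function.Injective (fun x : ℕ × ℕ => (x.1 + x.2, x.2)) := by
    rintro ⟨m, n⟩ ⟨m', n'⟩ h
    simp only [Prod.mk.injEq] at h
    ext <;> simp <;> omega
  have h := hasSum_dzetaSeries c b hr hs
  rw [← hinj.hasSum_iff] at h
  · refine hasSum_of_forall_eq ?_ h
    rintro ⟨m, n⟩
    simp only [Function.comp, dzetaTerm]
    rcases Nat.eq_zero_or_pos m with rfl | hm
    · simp [ind_zero]
    rw [if_pos (by omega)]
    rcases Nat.eq_zero_or_pos n with rfl | hn
    · simp [ind_zero]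
    have hadd : ind a m * ind b n = ind c (m + n) * ind b n := by
      simp only [ind]
      by_cases h2 : n % 2 = b.res
      · have : m % 2 = a.res ↔ (m + n) % 2 = c.res := by
          cases a <;> cases b <;> cases c <;> simp [Par.res] at hc h2 ⊢ <;> omega
        simp [hm, this]
      · simp [h2]
    rw [hadd]
    push_cast
    ring
  · rintro ⟨m, n⟩ hx
    simp only [dzetaTerm]
    rw [if_neg]
    intro hlt
    exact hx ⟨(m - n, n), by simp; omega⟩

theorem hasSum_dzetaSeries_add' {a b c : Par} (hc : (a.res + b.res) % 2 = c.res) {r s : ℕ}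
    (hr : 2 ≤ r) (hs : 1 ≤ s) :
    HasSum (fun x : ℕ × ℕ => ind a x.1 * ind b x.2
      * (1 / (((x.1 : ℝ) + x.2) ^ r * (x.1 : ℝ) ^ s))) (dzetaSeries c a r s) := by
  rw [add_comm] at hc
  have h := hasSum_dzetaSeries_add hc hr hs
  rw [← (Equiv.prodComm ℕ ℕ).hasSum_iff] at h
  convert h using 1
  ext x
  simp only [Function.comp, Equiv.prodComm_apply, Prod.fst_swap, Prod.snd_swap]
  ring

/-! ### Partial fractions -/

/-- The half of the partial fraction decomposition of `1 / (x ^ (a + 1) * y ^ (b + 1))` with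
poles in `t = x + y` and `y`. -/
def pfSum (a b : ℕ) (t y : ℝ) : ℝ :=
  ∑ p ∈ antidiagonal (a + b), (p.1.choose a : ℝ) * (1 / (t ^ (p.1 + 1) * y ^ (p.2 + 1)))

theorem pfSum_zero_zero (t y : ℝ) : pfSum 0 0 t y = 1 / (t * y) := by simp [pfSum]

theorem pfSum_zero_succ (b : ℕ) (t y : ℝ) :
    pfSum 0 (b + 1) t y = 1 / t * (1 / y ^ (b + 2) + pfSum 0 b t y) := by
  simp only [pfSum, zero_add]
  rw [Finset.Nat.sum_antidiagonal_succ, mul_add, Finset.mul_sum]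
  congr 1
  · simp
    ring
  · refine Finset.sum_congr rfl fun p _ => ?_
    simp [pow_succ]
    ring

theorem pfSum_succ (a b : ℕ) (t y : ℝ) : pfSum (a + 1) b t y
    = 1 / t * (pfSum a b t y + ∑ p ∈ antidiagonal (a + b),
      (p.1.choose (a + 1) : ℝ) * (1 / (t ^ (p.1 + 1) * y ^ (p.2 + 1)))) := by
  simp only [pfSum]
  rw [show a + 1 + b = a + b + 1 by ring, Finset.Nat.sum_antidiagonal_succ,
    ← Finset.sum_add_distrib, Finset.mul_sum]
  simp only [Nat.choose_zero_succ, Nat.cast_zero, zero_mul, zero_add]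
  refine Finset.sum_congr rfl fun p _ => ?_
  rw [Nat.choose_succ_succ, Nat.cast_add, pow_succ t (p.1 + 1), one_div, one_div, one_div, mul_inv,
    mul_inv, mul_inv]
  ring

theorem pfSum_succ_zero (a : ℕ) (t y : ℝ) : pfSum (a + 1) 0 t y = 1 / t * pfSum a 0 t y := by
  rw [pfSum_succ, Finset.sum_eq_zero, add_zero]
  intro p hp
  rw [mem_antidiagonal] at hp
  rw [Nat.choose_eq_zero_of_lt (by omega), Nat.cast_zero, zero_mul]

theorem pfSum_succ_succ (a b : ℕ) (t y : ℝ) : pfSum (a + 1) (b + 1) t y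
    = 1 / t * (pfSum a (b + 1) t y + pfSum (a + 1) b t y) := by
  rw [pfSum_succ, pfSum.eq_1 (a + 1) b, show a + 1 + b = a + (b + 1) by ring]

/-- Both sides obey the recursion coming from 1/(xy) = (1/x + 1/y)/(x + y); on the partial fraction
side it is Pascal's rule. -/
theorem pfSum_add_pfSum (a b : ℕ) {x y : ℝ} (hx : x ≠ 0) (hy : y ≠ 0) (hxy : x + y ≠ 0) :
    pfSum a b (x + y) y + pfSum b a (x + y) x = 1 / (x ^ (a + 1) * y ^ (b + 1)) := by
  induction a generalizing b with
  | zero =>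
    induction b with
    | zero =>
      rw [pfSum_zero_zero, pfSum_zero_zero]
      field_simp
      ring
    | succ b ih =>
      rw [pfSum_zero_succ, pfSum_succ_zero, ← mul_add, add_assoc, ih]
      field_simp
      ring
  | succ a iha =>
    induction b with
    | zero =>
      rw [pfSum_zero_succ, pfSum_succ_zero, ← mul_add, add_left_comm, iha]
      field_simp
      ring
    | succ b ihb =>
      have h : 1 / (x + y) * (1 / (x ^ (a + 1) * y ^ (b + 1 + 1))
          + 1 / (x ^ (a + 1 + 1) * y ^ (b + 1))) = 1 / (x ^ (a + 1 + 1) * y ^ (b + 1 + 1)) := by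
        field_simp
        ring
      rw [pfSum_succ_succ, pfSum_succ_succ]
      linear_combination 1 / (x + y) * iha (b + 1) + 1 / (x + y) * ihb + h

theorem partial_fraction (a b : ℕ) {x y : ℝ} (hx : x ≠ 0) (hy : y ≠ 0) (hxy : x + y ≠ 0) :
    1 / (x ^ (a + 1) * y ^ (b + 1)) = ∑ p ∈ antidiagonal (a + b),
      ((p.1.choose a : ℝ) * (1 / ((x + y) ^ (p.1 + 1) * y ^ (p.2 + 1)))
        + (p.1.choose b : ℝ) * (1 / ((x + y) ^ (p.1 + 1) * x ^ (p.2 + 1)))) := by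
  rw [← pfSum_add_pfSum a b hx hy hxy, Finset.sum_add_distrib, pfSum, pfSum, add_comm b a]

/-! ### Telescoping sums and log 2 -/

/-- The positive even integers are 2k + 2 and the odd ones 2k + 1, hence the offset 2 - `a.res`. -/
theorem hasSum_ind_mul (a : Par) (f : ℕ → ℝ) (v : ℝ) :
    HasSum (fun m => ind a m * f m) v ↔ HasSum (fun k => f (2 * k + (2 - a.res))) v := by
  have hinj : Function.Injective (fun k : ℕ => 2 * k + (2 - a.res)) := by
    intro k k' h
    simp only at h
    omega
  rw [← hinj.hasSum_iff]
  · have : ((fun m => ind a m * f m) ∘ fun k : ℕ => 2 * k + (2 - a.res))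
        = fun k => f (2 * k + (2 - a.res)) := by
      ext k
      simp only [Function.comp, ind]
      rw [if_pos, one_mul]
      cases a <;> simp [Par.res]
    rw [this]
  · intro m hm
    rw [ind, if_neg, zero_mul]
    rintro ⟨h1, h2⟩
    refine hm ⟨(m - (2 - a.res)) / 2, ?_⟩
    cases a <;> simp [Par.res] at h2 ⊢ <;> omega

theorem hasSum_telescope {f : ℕ → ℝ} (hf : Antitone f) (h0 : Tendsto f atTop (𝓝 0)) :
    HasSum (fun k => f k - f (k + 1)) (f 0) := by
  rw [hasSum_iff_tendsto_nat_of_nonneg fun k => sub_nonneg.2 (hf (Nat.le_succ k))]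
  simp only [Finset.sum_range_sub']
  simpa using h0.const_sub (f 0)

theorem hasSum_inv_telescope {c : ℝ} (hc : 0 < c) :
    HasSum (fun k : ℕ => 1 / (2 * (k : ℝ) + c) - 1 / (2 * (k : ℝ) + c + 2)) (1 / c) := by
  have h := hasSum_telescope (f := fun k : ℕ => 1 / (2 * (k : ℝ) + c)) ?_ ?_
  · simp only [Nat.cast_zero, mul_zero, zero_add] at h
    convert h using 1
    ext k
    push_cast
    ring
  · intro k k' h
    have : (k : ℝ) ≤ k' := by exact_mod_cast h
    simp only
    gcongr
  · refine Tendsto.div_atTop tendsto_const_nhds ?_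
    refine tendsto_atTop_add_const_right _ _ ?_
    exact tendsto_natCast_atTop_atTop.const_mul_atTop (by norm_num)

/-- The partial sums are H_{2N} - H_N, and Euler's constant cancels in the limit. -/
theorem hasSum_log_two :
    HasSum (fun k : ℕ => 1 / (2 * (k : ℝ) + 1) - 1 / (2 * (k : ℝ) + 2)) (Real.log 2) := by
  rw [hasSum_iff_tendsto_nat_of_nonneg]
  · have hsum : ∀ N : ℕ, ∑ k ∈ range N, (1 / (2 * (k : ℝ) + 1) - 1 / (2 * (k : ℝ) + 2))
        = harmonic (2 * N) - harmonic N := by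
      intro N
      induction N with
      | zero => simp
      | succ N ih =>
        rw [Finset.sum_range_succ, ih, show 2 * (N + 1) = 2 * N + 1 + 1 by ring, harmonic_succ,
          harmonic_succ, harmonic_succ]
        push_cast
        have h1 : (2 * (N : ℝ) + 1) ≠ 0 := by positivity
        have h2 : ((N : ℝ) + 1) ≠ 0 := by positivity
        field_simp
        ring
    have h1 := Real.tendsto_harmonic_sub_log
    have h2 : Tendsto (fun N : ℕ => 2 * N) atTop atTop :=
      tendsto_id.const_mul_atTop' (by norm_num)
    have h3 := ((h1.comp h2).sub h1).add_const (Real.log 2)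
    simp only [sub_self, zero_add] at h3
    refine h3.congr' ?_
    filter_upwards [eventually_gt_atTop 0] with N hN
    have hN' : (N : ℝ) ≠ 0 := by exact_mod_cast hN.ne'
    rw [hsum]
    simp only [Function.comp]
    push_cast
    rw [Real.log_mul two_ne_zero hN']
    ring
  · intro k
    rw [sub_nonneg]
    gcongr
    norm_num

/-- The constants in `hasSum_ind_mul_sub`. -/
def shiftConst : Par → ℕ → ℝ
  | .od, n => (n % 2 : ℕ) * Real.log 2
  | .ev, n => -((n % 2 : ℕ) * Real.log 2)

/-- For even n the sum telescopes within one parity class. For odd n the shift changes the class and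
leaves ±log 2. Hence the induction in steps of two. -/
theorem hasSum_ind_mul_sub (a : Par) (n : ℕ) :
    HasSum (fun m : ℕ => ind a m * (1 / (m : ℝ) - 1 / ((m : ℝ) + n)))
      (shiftConst a n
        + ∑ l ∈ range (n + 1), if 0 < l ∧ (l + n) % 2 = a.res then 1 / (l : ℝ) else 0) := by
  induction n using Nat.twoStepInduction with
  | zero =>
    cases a <;> simp [shiftConst, hasSum_zero]
  | one =>
    rw [hasSum_ind_mul]
    cases a
    · have h1 := (hasSum_inv_telescope one_pos).sub hasSum_log_two
      have hv : shiftConst .ev 1 + (∑ l ∈ range (1 + 1),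
          if 0 < l ∧ (l + 1) % 2 = Par.ev.res then 1 / (l : ℝ) else 0)
            = 1 / 1 - Real.log 2 := by
        simp [shiftConst, Par.res, Finset.sum_range_succ]
        ring
      rw [hv]
      refine hasSum_of_forall_eq (fun k => ?_) h1
      simp only [Par.res]
      push_cast
      ring
    · have hv : shiftConst .od 1 + (∑ l ∈ range (1 + 1),
          if 0 < l ∧ (l + 1) % 2 = Par.od.res then 1 / (l : ℝ) else 0) = Real.log 2 := by
        simp [shiftConst, Par.res, Finset.sum_range_succ]
      rw [hv]
      refine hasSum_of_forall_eq (fun k => ?_) hasSum_log_two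
      simp only [Par.res]
      push_cast
      ring
  | more n ih _ =>
    have h2 : HasSum (fun m : ℕ => ind a m * (1 / ((m : ℝ) + n) - 1 / ((m : ℝ) + (n + 2))))
        (1 / (((2 - a.res : ℕ) : ℝ) + n)) := by
      rw [hasSum_ind_mul]
      have hpos : (0 : ℝ) < ((2 - a.res : ℕ) : ℝ) + n := by
        cases a <;> simp [Par.res] <;> positivity
      convert hasSum_inv_telescope hpos using 1
      ext k
      push_cast
      ring
    have hs : ∀ l, (l + (n + 2)) % 2 = (l + n) % 2 := fun l => by omega
    have hk : shiftConst a (n + 2) = shiftConst a n := by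
      cases a <;> simp [shiftConst]
    have hv : (shiftConst a (n + 2)
        + ∑ l ∈ range (n + 2 + 1), if 0 < l ∧ (l + (n + 2)) % 2 = a.res then 1 / (l : ℝ) else 0)
        = (shiftConst a n
        + ∑ l ∈ range (n + 1), if 0 < l ∧ (l + n) % 2 = a.res then 1 / (l : ℝ) else 0)
          + 1 / (((2 - a.res : ℕ) : ℝ) + n) := by
      -- Of the two new indices exactly one has the required parity; it is the first term of the
      -- telescoping series from n to n + 2.
      have e : ((if 0 < n + 1 ∧ (n + 1 + n) % 2 = a.res then 1 / ((n + 1 : ℕ) : ℝ) else 0)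
          + if 0 < n + 2 ∧ (n + 2 + n) % 2 = a.res then 1 / ((n + 2 : ℕ) : ℝ) else 0)
          = 1 / (((2 - a.res : ℕ) : ℝ) + n) := by
        cases a
        · rw [if_neg (by simp [Par.res]; omega), if_pos (by simp [Par.res]; omega)]
          simp only [Par.res]
          push_cast
          ring
        · rw [if_pos (by simp [Par.res]; omega), if_neg (by simp [Par.res]; omega)]
          simp only [Par.res]
          push_cast
          ring
      rw [Finset.sum_range_succ, Finset.sum_range_succ]
      simp only [hs, hk]
      linear_combination e
    rw [hv]
    refine hasSum_of_forall_eq (fun m => ?_) (ih.add h2)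
    push_cast
    ring

/-! ### Stuffle and shuffle of convergent zeta values -/

theorem hasSum_zeta_mul_zeta (a b : Par) {r s : ℕ} (hr : 2 ≤ r) (hs : 2 ≤ s) :
    HasSum (fun x : ℕ × ℕ => ind a x.1 / (x.1 : ℝ) ^ r * (ind b x.2 / (x.2 : ℝ) ^ s))
      (zetaSeries a r * zetaSeries b s) := by
  have h1 := hasSum_zetaSeries a hr
  have h2 := hasSum_zetaSeries b hs
  exact h1.mul h2 (h1.summable.mul_of_nonneg h2.summable
    (fun n => div_nonneg (ind_nonneg _ _) (by positivity))
    (fun n => div_nonneg (ind_nonneg _ _) (by positivity)))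

theorem ind_mul_ind_of_res_ne {a b : Par} (h : a.res ≠ b.res) (n : ℕ) :
    ind a n * ind b n = 0 := by
  simp only [ind]
  split_ifs with h1 h2 <;> simp
  omega

theorem res_inj {a b : Par} : a.res = b.res ↔ a = b := by
  cases a <;> cases b <;> simp [Par.res]

theorem hasSum_zeta_add (a b : Par) {k : ℕ} (hk : 2 ≤ k) :
    HasSum (fun n : ℕ => ind a n * ind b n / (n : ℝ) ^ k)
      (if a.res = b.res then zetaSeries a k else 0) := by
  split_ifs with h
  · rw [res_inj] at h
    subst h
    simp only [ind_mul_self]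
    exact hasSum_zetaSeries a hk
  · simp only [ind_mul_ind_of_res_ne h, zero_div]
    exact hasSum_zero

theorem zeta_stuffle (a b : Par) {r s : ℕ} (hr : 2 ≤ r) (hs : 2 ≤ s) :
    zetaSeries a r * zetaSeries b s = dzetaSeries a b r s + dzetaSeries b a s r
      + if a.res = b.res then zetaSeries a (r + s) else 0 := by
  have h1 := hasSum_dzetaSeries a b hr (by omega : 1 ≤ s)
  have h2 := hasSum_dzetaSeries b a hs (by omega : 1 ≤ r)
  rw [← (Equiv.prodComm ℕ ℕ).hasSum_iff] at h2
  have h3 := hasSum_zeta_add a b (by omega : 2 ≤ r + s)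
  have hinj : Function.Injective (fun n : ℕ => (n, n)) := fun n m h => by simpa using h
  have h4 : HasSum (fun x : ℕ × ℕ => if x.1 = x.2 then
      ind a x.1 * ind b x.2 / ((x.1 : ℝ) ^ r * (x.2 : ℝ) ^ s) else 0)
      (if a.res = b.res then zetaSeries a (r + s) else 0) := by
    rw [← hinj.hasSum_iff]
    · refine hasSum_of_forall_eq (fun n => ?_) h3
      simp [pow_add]
    · rintro ⟨m, n⟩ h
      exact if_neg fun hmn => h ⟨m, Prod.ext rfl hmn⟩
  refine (hasSum_zeta_mul_zeta a b hr hs).unique (hasSum_of_forall_eq ?_ ((h1.add h2).add h4))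
  rintro ⟨m, n⟩
  simp only [dzetaTerm, Function.comp, Equiv.prodComm_apply, Prod.swap_prod_mk]
  rcases lt_trichotomy m n with h | h | h
  · simp [h, h.le.not_gt, h.ne]
    ring
  · subst h
    simp
    ring
  · simp [h, h.le.not_gt, h.ne']
    ring

theorem zeta_shuffle {a b c : Par} (hc : (a.res + b.res) % 2 = c.res) {r s : ℕ}
    (hr : r ≠ 0) (hs : s ≠ 0) :
    zetaSeries a (r + 1) * zetaSeries b (s + 1) = ∑ p ∈ antidiagonal (r + s),
      ((p.1.choose r : ℝ) * dzetaSeries c b (p.1 + 1) (p.2 + 1)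
        + (p.1.choose s : ℝ) * dzetaSeries c a (p.1 + 1) (p.2 + 1)) := by
  refine (hasSum_zeta_mul_zeta a b (by omega) (by omega)).unique ?_
  have h : HasSum (fun x : ℕ × ℕ => ∑ p ∈ antidiagonal (r + s),
      ((p.1.choose r : ℝ) * (ind a x.1 * ind b x.2
          * (1 / (((x.1 : ℝ) + x.2) ^ (p.1 + 1) * (x.2 : ℝ) ^ (p.2 + 1))))
        + (p.1.choose s : ℝ) * (ind a x.1 * ind b x.2
          * (1 / (((x.1 : ℝ) + x.2) ^ (p.1 + 1) * (x.1 : ℝ) ^ (p.2 + 1))))))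
      (∑ p ∈ antidiagonal (r + s),
      ((p.1.choose r : ℝ) * dzetaSeries c b (p.1 + 1) (p.2 + 1)
        + (p.1.choose s : ℝ) * dzetaSeries c a (p.1 + 1) (p.2 + 1))) := by
    refine hasSum_sum fun p _ => ?_
    -- The double series with first exponent 1 diverge, but their binomial coefficients vanish
    -- because r and s are nonzero.
    rcases Nat.eq_zero_or_pos p.1 with h0 | h0
    · simp only [h0, Nat.choose_eq_zero_of_lt (Nat.pos_of_ne_zero hr),
        Nat.choose_eq_zero_of_lt (Nat.pos_of_ne_zero hs), Nat.cast_zero, zero_mul, add_zero]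
      exact hasSum_zero
    · exact ((hasSum_dzetaSeries_add hc (by omega) (by omega)).mul_left _).add
        ((hasSum_dzetaSeries_add' hc (by omega) (by omega)).mul_left _)
  refine hasSum_of_forall_eq ?_ h
  rintro ⟨m, n⟩
  rcases Nat.eq_zero_or_pos m with rfl | hm
  · simp [ind_zero]
  rcases Nat.eq_zero_or_pos n with rfl | hn
  · simp [ind_zero]
  have hm' : (0 : ℝ) < m := by exact_mod_cast hm
  have hn' : (0 : ℝ) < n := by exact_mod_cast hn
  have := partial_fraction r s hm'.ne' hn'.ne' (by positivity)
  rw [show ind a m / (m : ℝ) ^ (r + 1) * (ind b n / (n : ℝ) ^ (s + 1))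
    = ind a m * ind b n * (1 / ((m : ℝ) ^ (r + 1) * (n : ℝ) ^ (s + 1))) by field_simp, this,
    Finset.mul_sum]
  refine Finset.sum_congr rfl fun p _ => ?_
  ring

/-! ### The regularized shuffle relation -/

theorem hasSum_dzetaSeries_one (a b : Par) {r : ℕ} (hr : 2 ≤ r) :
    HasSum (fun n : ℕ => ind a n / (n : ℝ) ^ r * ∑ l ∈ range n, ind b l / (l : ℝ))
      (dzetaSeries a b r 1) := by
  refine (hasSum_dzetaSeries a b hr le_rfl).prod_fiberwise fun n => ?_
  have h : ∀ l ∉ range n, dzetaTerm a b r 1 (n, l) = 0 := by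
    intro l hl
    rw [mem_range] at hl
    simp [dzetaTerm, hl]
  have e : ∑ l ∈ range n, dzetaTerm a b r 1 (n, l)
      = ind a n / (n : ℝ) ^ r * ∑ l ∈ range n, ind b l / (l : ℝ) := ?_
  · rw [← e]
    exact hasSum_sum_of_ne_finset_zero h
  rw [Finset.mul_sum]
  refine Finset.sum_congr rfl fun l hl => ?_
  rw [mem_range] at hl
  simp only [dzetaTerm, if_pos hl, pow_one]
  rw [div_mul_div_comm]

/-- The constant in the regularized shuffle relation. -/
def regConst (a b : Par) : ℝ := shiftConst a b.res

/-- Partial fractions of 1/(m n^{s+2}) contain a single divergent term, 1/((m + n) n^{s+2});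
subtracting it makes the double sum converge. -/
theorem hasSum_shuffle_regularized {a b c : Par} (hc : (a.res + b.res) % 2 = c.res) (s : ℕ) :
    HasSum (fun x : ℕ × ℕ => ind b x.1 / (x.1 : ℝ) ^ (s + 2)
      * (ind a x.2 * (1 / (x.2 : ℝ) - 1 / ((x.2 : ℝ) + x.1))))
      (∑ p ∈ antidiagonal s, (dzetaSeries c b (p.1 + 2) (p.2 + 1)
        + ((p.1 + 1).choose (s + 1) : ℝ) * dzetaSeries c a (p.1 + 2) (p.2 + 1))) := by
  have h : HasSum (fun x : ℕ × ℕ => ∑ p ∈ antidiagonal s,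
      (ind a x.1 * ind b x.2
          * (1 / (((x.1 : ℝ) + x.2) ^ (p.1 + 2) * (x.2 : ℝ) ^ (p.2 + 1)))
        + ((p.1 + 1).choose (s + 1) : ℝ) * (ind a x.1 * ind b x.2
          * (1 / (((x.1 : ℝ) + x.2) ^ (p.1 + 2) * (x.1 : ℝ) ^ (p.2 + 1))))))
      (∑ p ∈ antidiagonal s, (dzetaSeries c b (p.1 + 2) (p.2 + 1)
        + ((p.1 + 1).choose (s + 1) : ℝ) * dzetaSeries c a (p.1 + 2) (p.2 + 1))) :=
    hasSum_sum fun p _ => (hasSum_dzetaSeries_add hc (by omega) (by omega)).add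
        ((hasSum_dzetaSeries_add' hc (by omega) (by omega)).mul_left _)
  rw [← (Equiv.prodComm ℕ ℕ).hasSum_iff] at h
  refine hasSum_of_forall_eq ?_ h
  rintro ⟨n, m⟩
  simp only [Function.comp, Equiv.prodComm_apply, Prod.swap_prod_mk]
  rcases Nat.eq_zero_or_pos m with rfl | hm
  · simp [ind_zero]
  rcases Nat.eq_zero_or_pos n with rfl | hn
  · simp [ind_zero]
  have hm' : (0 : ℝ) < m := by exact_mod_cast hm
  have hn' : (0 : ℝ) < n := by exact_mod_cast hn
  have := partial_fraction 0 (s + 1) hm'.ne' hn'.ne' (by positivity)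
  -- The term p.1 = 0 is split off; it is the divergent one, cancelled by the subtraction.
  rw [zero_add (s + 1), Finset.Nat.sum_antidiagonal_succ] at this
  simp only [Nat.choose_zero_succ, Nat.choose_zero_right, Nat.cast_zero, Nat.cast_one, one_mul,
    zero_mul, add_zero, zero_add, pow_one] at this
  have e : ind b n / (n : ℝ) ^ (s + 2) * (ind a m * (1 / (m : ℝ) - 1 / ((m : ℝ) + n)))
    = ind a m * ind b n * (1 / ((m : ℝ) * (n : ℝ) ^ (s + 1 + 1))
      - 1 / (((m : ℝ) + n) * (n : ℝ) ^ (s + 1 + 1))) := by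
    field_simp
  rw [e, this, add_sub_cancel_left, Finset.mul_sum]
  refine Finset.sum_congr rfl fun p _ => ?_
  ring

/-- The convergent double sum is evaluated in two ways: by partial fractions, and by summing over m
first with `hasSum_ind_mul_sub`. -/
theorem zeta_shuffle_one {a b c : Par} (hc : (a.res + b.res) % 2 = c.res) (s : ℕ) :
    regConst a b * zetaSeries b (s + 2) + dzetaSeries b c (s + 2) 1
        + (if b.res = c.res then zetaSeries b (s + 3) else 0)
      = ∑ p ∈ antidiagonal s, (dzetaSeries c b (p.1 + 2) (p.2 + 1)
        + ((p.1 + 1).choose (s + 1) : ℝ) * dzetaSeries c a (p.1 + 2) (p.2 + 1)) := by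
  have h2 : HasSum (fun n : ℕ => ind b n / (n : ℝ) ^ (s + 2) * (shiftConst a n
      + ∑ l ∈ range (n + 1), if 0 < l ∧ (l + n) % 2 = a.res then 1 / (l : ℝ) else 0)) _ :=
    (hasSum_shuffle_regularized hc s).prod_fiberwise fun n =>
      (hasSum_ind_mul_sub a n).mul_left (ind b n / (n : ℝ) ^ (s + 2))
  refine HasSum.unique ?_ h2
  have h3 := (((hasSum_zetaSeries b (by omega : 2 ≤ s + 2)).mul_left (regConst a b)).add
    (hasSum_dzetaSeries_one b c (by omega : 2 ≤ s + 2))).add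
    (hasSum_zeta_add b c (by omega : 2 ≤ s + 3))
  refine hasSum_of_forall_eq (fun n => ?_) h3
  by_cases hb : 0 < n ∧ n % 2 = b.res
  · have hn : (0 : ℝ) < n := by exact_mod_cast hb.1
    have e1 : shiftConst a n = regConst a b := by
      simp only [regConst]
      cases a <;> cases b <;> simp [shiftConst, Par.res] at hb ⊢ <;> simp [hb.2]
    have e2 : ∀ l : ℕ, (if 0 < l ∧ (l + n) % 2 = a.res then 1 / (l : ℝ) else 0)
        = ind c l / (l : ℝ) := by
      intro l
      have : (l + n) % 2 = a.res ↔ l % 2 = c.res := by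
        cases a <;> cases b <;> cases c <;> simp [Par.res] at hb hc ⊢ <;> omega
      simp only [this, ind]
      split_ifs <;> simp
    simp only [e1, e2]
    -- The term l = n is the source of the single zeta value; l < n gives the double one.
    rw [Finset.sum_range_succ, pow_succ _ (s + 2)]
    field_simp
    ring
  · simp [ind, hb]

/-! ### Relations for the regularized values in ℂ[T] -/

theorem cst_add (x y : ℝ) : cst (x + y) = cst x + cst y := by simp [cst]

theorem cst_neg (x : ℝ) : cst (-x) = -cst x := by simp [cst]

theorem cst_mul (x y : ℝ) : cst (x * y) = cst x * cst y := by simp [cst]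

theorem cst_zero : cst 0 = 0 := by simp [cst]

theorem cst_natCast (n : ℕ) : cst n = n := by simp [cst]

theorem cst_sum {ι : Type*} (s : Finset ι) (f : ι → ℝ) : cst (∑ i ∈ s, f i) = ∑ i ∈ s, cst (f i) := by
  simp [cst]

theorem zetaE_add_two (k : ℕ) : zetaE (k + 2) = cst (zetaSeries .ev (k + 2)) := by
  simp [zetaE]

theorem zetaO_add_two (k : ℕ) : zetaO (k + 2) = cst (zetaSeries .od (k + 2)) := by
  simp [zetaO]

theorem zetaOE_add_two (k s : ℕ) : zetaOE (k + 2) s = cst (dzetaSeries .od .ev (k + 2) s) := by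
  simp [zetaOE]

theorem zetaEO_add_two (k s : ℕ) : zetaEO (k + 2) s = cst (dzetaSeries .ev .od (k + 2) s) := by
  simp [zetaEO]

theorem zetaOO_add_two (k s : ℕ) : zetaOO (k + 2) s = cst (dzetaSeries .od .od (k + 2) s) := by
  simp [zetaOO]

theorem zetaE_one : zetaE 1 = cst (1 / 2) * (T + cst L1) := by simp [zetaE]

theorem zetaO_one : zetaO 1 = cst (1 / 2) * (T - cst L1) := by simp [zetaO]

theorem zetaOE_one (s : ℕ) : zetaOE 1 s = cst (1 / 2) * zetaE s * T
    - cst (1 / 2) * cst L1 * zetaE s - cst (dzetaSeries .ev .od s 1) := by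
  simp [zetaOE]

theorem zetaEO_one (s : ℕ) : zetaEO 1 s = cst (1 / 2) * zetaO s * T
    + cst (1 / 2) * cst L1 * zetaO s - cst (dzetaSeries .od .ev s 1) := by
  simp [zetaEO]

theorem zetaOO_one (s : ℕ) : zetaOO 1 s = cst (1 / 2) * zetaO s * T
    - cst (1 / 2) * cst L1 * zetaO s - cst (dzetaSeries .od .od s 1) - zetaO (s + 1) := by
  simp [zetaOO]

theorem zetaO_mul_zetaE_stuffle (a b : ℕ) (h : a + b ≠ 0) :
    zetaO (a + 1) * zetaE (b + 1) = zetaOE (a + 1) (b + 1) + zetaEO (b + 1) (a + 1) := by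
  rcases a with _ | a <;> rcases b with _ | b
  · exact absurd rfl h
  · simp only [zero_add, zetaO_one, zetaOE_one, zetaEO_add_two, add_assoc, Nat.reduceAdd]
    ring
  · simp only [zero_add, zetaE_one, zetaEO_one, zetaOE_add_two, add_assoc, Nat.reduceAdd]
    ring
  · simp only [add_assoc, Nat.reduceAdd, zetaE_add_two, zetaO_add_two, zetaEO_add_two,
      zetaOE_add_two]
    rw [← cst_mul, ← cst_add, zeta_stuffle .od .ev (by omega) (by omega), if_neg (by simp [Par.res]),
      add_zero]

theorem zetaO_mul_zetaO_stuffle (a b : ℕ) (h : a + b ≠ 0) :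
    zetaO (a + 1) * zetaO (b + 1) = zetaOO (a + 1) (b + 1) + zetaOO (b + 1) (a + 1)
      + zetaO (a + b + 2) := by
  rcases a with _ | a <;> rcases b with _ | b
  · exact absurd rfl h
  · simp only [zero_add, zetaO_one, zetaOO_one, zetaOO_add_two, add_assoc, Nat.reduceAdd]
    ring
  · simp only [zero_add, zetaO_one, zetaOO_one, zetaOO_add_two, add_assoc, Nat.reduceAdd]
    ring
  · have e : a + 1 + (b + 1) + 2 = a + 2 + (b + 2) := by ring
    rw [zetaO_add_two (a + 1 + (b + 1)), e]
    simp only [add_assoc, Nat.reduceAdd, zetaO_add_two, zetaOO_add_two]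
    rw [← cst_mul, ← cst_add, ← cst_add, zeta_stuffle .od .od (by omega) (by omega), if_pos rfl]
    simp only [add_assoc]

/-- Only values with first index at least 2 have nonzero coefficients, so `f` and `h` may be any
regularization. -/
theorem cst_zeta_shuffle {a b c : Par} (hc : (a.res + b.res) % 2 = c.res) {r s : ℕ}
    (hr : r ≠ 0) (hs : s ≠ 0) {f h : ℕ → ℕ → Polynomial ℂ}
    (hf : ∀ k s, f (k + 2) s = cst (dzetaSeries c b (k + 2) s))
    (hh : ∀ k s, h (k + 2) s = cst (dzetaSeries c a (k + 2) s)) :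
    cst (zetaSeries a (r + 1)) * cst (zetaSeries b (s + 1)) = ∑ p ∈ antidiagonal (r + s),
      (p.1.choose r • f (p.1 + 1) (p.2 + 1) + p.1.choose s • h (p.1 + 1) (p.2 + 1)) := by
  rw [← cst_mul, zeta_shuffle hc hr hs, cst_sum]
  refine Finset.sum_congr rfl ?_
  rintro ⟨i, j⟩ _
  rcases i with _ | i
  · simp [Nat.choose_eq_zero_of_lt (Nat.pos_of_ne_zero hr),
      Nat.choose_eq_zero_of_lt (Nat.pos_of_ne_zero hs), cst_zero]
  · simp only [hf, hh, cst_add, cst_mul, cst_natCast, nsmul_eq_mul]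

/-- The regularized value `f 1 (s + 2)` is left untouched; inserting its definition yields the
product with ζ(1). -/
theorem cst_zeta_shuffle_one {a b c : Par} (hc : (a.res + b.res) % 2 = c.res) (s : ℕ)
    {f h : ℕ → ℕ → Polynomial ℂ}
    (hf : ∀ k s, f (k + 2) s = cst (dzetaSeries c b (k + 2) s))
    (hh : ∀ k s, h (k + 2) s = cst (dzetaSeries c a (k + 2) s)) :
    ∑ p ∈ antidiagonal (s + 1),
      (p.1.choose 0 • f (p.1 + 1) (p.2 + 1) + p.1.choose (s + 1) • h (p.1 + 1) (p.2 + 1))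
      = f 1 (s + 2) + cst (regConst a b) * cst (zetaSeries b (s + 2))
        + cst (dzetaSeries b c (s + 2) 1)
        + if b.res = c.res then cst (zetaSeries b (s + 3)) else 0 := by
  have key := congrArg cst (zeta_shuffle_one hc s)
  rw [cst_sum, cst_add, cst_add, cst_mul, apply_ite cst, cst_zero] at key
  rw [Finset.Nat.sum_antidiagonal_succ]
  simp only [Nat.choose_zero_succ, Nat.choose_zero_right, one_smul, zero_smul, zero_add, add_zero]
  have e : ∑ p ∈ antidiagonal s, (f (p.1 + 1 + 1) (p.2 + 1)
      + (p.1 + 1).choose (s + 1) • h (p.1 + 1 + 1) (p.2 + 1))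
      = ∑ p ∈ antidiagonal s, cst (dzetaSeries c b (p.1 + 2) (p.2 + 1)
        + ((p.1 + 1).choose (s + 1) : ℝ) * dzetaSeries c a (p.1 + 2) (p.2 + 1)) :=
    Finset.sum_congr rfl fun p _ => by
      simp only [add_assoc, Nat.reduceAdd, hf, hh, cst_add, cst_mul, cst_natCast, nsmul_eq_mul]
  rw [e, ← key, add_assoc s]
  ring

theorem cst_half : cst (1 / 2) * 2 = 1 := by
  rw [show (2 : Polynomial ℂ) = cst 2 by simp [cst, map_ofNat Polynomial.C 2], ← cst_mul]
  norm_num [cst]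

theorem regConst_od_od : regConst .od .od = -L1 := by simp [regConst, shiftConst, L1, Par.res]

theorem regConst_ev_od : regConst .ev .od = L1 := by simp [regConst, shiftConst, L1, Par.res]

theorem regConst_od_ev : regConst .od .ev = 0 := by simp [regConst, shiftConst, Par.res]

theorem zetaO_mul_zetaE_shuffle (a b : ℕ) (h : a + b ≠ 0) :
    zetaO (a + 1) * zetaE (b + 1) = ∑ p ∈ antidiagonal (a + b),
      (p.1.choose a • zetaOE (p.1 + 1) (p.2 + 1) + p.1.choose b • zetaOO (p.1 + 1) (p.2 + 1)) := by
  rcases a with _ | a <;> rcases b with _ | b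
  · exact absurd rfl h
  · have key := cst_zeta_shuffle_one (a := .od) (b := .ev) (c := .od) rfl b zetaOE_add_two
      zetaOO_add_two
    rw [regConst_od_ev, cst_zero, if_neg (by simp [Par.res])] at key
    rw [zero_add (b + 1), key]
    simp only [zero_add, zetaO_one, zetaOE_one, zetaE_add_two, add_assoc, Nat.reduceAdd]
    ring
  · have key := cst_zeta_shuffle_one (a := .ev) (b := .od) (c := .od) rfl a zetaOO_add_two
      zetaOE_add_two
    rw [regConst_ev_od, if_pos rfl] at key
    simp only [add_comm (Nat.choose _ 0 • _)] at key
    rw [add_zero (a + 1), key]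
    simp only [zero_add, zetaE_one, zetaOO_one, zetaO_add_two, add_assoc, Nat.reduceAdd]
    linear_combination (cst L1 * cst (zetaSeries .od (a + 2))) * cst_half
  · have := cst_zeta_shuffle (a := .od) (b := .ev) (c := .od) rfl (Nat.succ_ne_zero a)
      (Nat.succ_ne_zero b) zetaOE_add_two zetaOO_add_two
    rw [← this]
    simp only [add_assoc, Nat.reduceAdd, zetaE_add_two, zetaO_add_two, Nat.succ_eq_add_one]

theorem zetaO_mul_zetaO_shuffle (a b : ℕ) (h : a + b ≠ 0) :
    zetaO (a + 1) * zetaO (b + 1) = ∑ p ∈ antidiagonal (a + b),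
      (p.1.choose a • zetaEO (p.1 + 1) (p.2 + 1) + p.1.choose b • zetaEO (p.1 + 1) (p.2 + 1)) := by
  have one : ∀ b, zetaO 1 * zetaO (b + 2) = ∑ p ∈ antidiagonal (b + 1),
      (p.1.choose 0 • zetaEO (p.1 + 1) (p.2 + 1)
        + p.1.choose (b + 1) • zetaEO (p.1 + 1) (p.2 + 1)) := by
    intro b
    have key := cst_zeta_shuffle_one (a := .od) (b := .od) (c := .ev) rfl b zetaEO_add_two
      zetaEO_add_two
    rw [regConst_od_od, if_neg (by simp [Par.res]), cst_neg] at key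
    rw [key]
    simp only [zetaO_one, zetaEO_one, zetaO_add_two]
    linear_combination (-cst L1 * cst (zetaSeries .od (b + 2))) * cst_half
  rcases a with _ | a <;> rcases b with _ | b
  · exact absurd rfl h
  · simpa only [zero_add] using one b
  · have := one a
    simp only [add_comm (Nat.choose _ 0 • _)] at this
    simpa only [zero_add, mul_comm] using this
  · have := cst_zeta_shuffle (a := .od) (b := .od) (c := .ev) rfl (Nat.succ_ne_zero a)
      (Nat.succ_ne_zero b) zetaEO_add_two zetaEO_add_two
    rw [← this]
    simp only [add_assoc, Nat.reduceAdd, zetaO_add_two, Nat.succ_eq_add_one]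

/-! ### Normalization and Euler's formula for even weights -/

theorem normalize_add (k : ℕ) (z w : Polynomial ℂ) :
    normalize k (z + w) = normalize k z + normalize k w := by
  simp [normalize, mul_add]

theorem normalize_nsmul (k n : ℕ) (z : Polynomial ℂ) :
    normalize k (n • z) = n • normalize k z := by
  simp only [normalize, nsmul_eq_mul, mul_left_comm _ (n : Polynomial ℂ), map_mul, map_natCast]

theorem normalize_sum {ι : Type*} (k : ℕ) (s : Finset ι) (z : ι → Polynomial ℂ) :
    normalize k (∑ i ∈ s, z i) = ∑ i ∈ s, normalize k (z i) := by
  simp [normalize, Finset.mul_sum]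

theorem normalize_mul_normalize (k l : ℕ) (z w : Polynomial ℂ) :
    normalize k z * normalize l w = normalize (k + l) (z * w) := by
  simp only [normalize, ← map_mul, pow_add, mul_inv]
  congr 1
  rw [map_mul]
  ring

theorem incl_smul (c : ℚ) (f : PowerSeries ℚ) : incl (c • f) = c • incl f := map_rat_smul incl c f

theorem zetaSeries_ev_of_hasSum {k : ℕ} (hk : 2 ≤ k) {v : ℝ}
    (hv : HasSum (fun n : ℕ => 1 / (n : ℝ) ^ k) v) : zetaSeries .ev k = v / 2 ^ k := by
  refine (hasSum_zetaSeries .ev hk).unique ?_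
  have hinj : Function.Injective (fun n : ℕ => 2 * n) := fun m n h => by simpa using h
  rw [← hinj.hasSum_iff]
  · refine hasSum_of_forall_eq (fun n => ?_) (hv.div_const (2 ^ k))
    rcases Nat.eq_zero_or_pos n with rfl | hn
    · simp [ind_zero, show k ≠ 0 by omega]
    · simp [ind, Par.res, hn, mul_pow]
      ring
  · intro n hn
    rw [ind, if_neg, zero_div]
    rintro ⟨_, h⟩
    exact hn ⟨n / 2, by simp [Par.res] at h ⊢; omega⟩

theorem zetaSeries_od_of_hasSum {k : ℕ} (hk : 2 ≤ k) {v : ℝ}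
    (hv : HasSum (fun n : ℕ => 1 / (n : ℝ) ^ k) v) : zetaSeries .od k = v - v / 2 ^ k := by
  rw [← zetaSeries_ev_of_hasSum hk hv, eq_sub_iff_add_eq]
  refine ((hasSum_zetaSeries .od hk).add (hasSum_zetaSeries .ev hk)).unique
    (hasSum_of_forall_eq (fun n => ?_) hv)
  rcases Nat.eq_zero_or_pos n with rfl | hn
  · simp [ind_zero, show k ≠ 0 by omega]
  · rcases Nat.mod_two_eq_zero_or_one n with h | h <;> simp [ind, Par.res, hn, h]

theorem rat_smul_one (c : ℚ) :
    c • (1 : PowerSeries (Polynomial ℂ)) = PowerSeries.C (Polynomial.C (c : ℂ)) := by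
  have : c • (1 : PowerSeries ℚ) = PowerSeries.C c := by
    rw [PowerSeries.smul_eq_C_mul, mul_one]
  rw [← map_one incl, ← incl_smul, this, incl, PowerSeries.map_C]
  rfl

/-- Dividing Euler's formula for ζ(2k) by (2πi)^{2k} removes π and leaves the sign -1. The factor c
is for the restriction to one parity. -/
theorem normalize_cst_of_even {k : ℕ} (hk : k ≠ 0) (c : ℚ) :
    normalize (2 * k) (cst (((-1 : ℝ) ^ (k + 1) * (2 : ℝ) ^ (2 * k - 1) * Real.pi ^ (2 * k)
        * bernoulli (2 * k) / (2 * k).factorial) * c))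
      = (-bernoulli (2 * k) / (2 * (2 * k).factorial) * c) • 1 := by
  rw [rat_smul_one, normalize, cst, ← map_mul]
  congr 2
  obtain ⟨k, rfl⟩ := Nat.exists_eq_succ_of_ne_zero hk
  have hpi : (Real.pi : ℂ) ≠ 0 := by exact_mod_cast Real.pi_ne_zero
  rw [show 2 * k.succ - 1 = 2 * k + 1 by omega, mul_pow, mul_pow, pow_mul Complex.I, Complex.I_sq]
  push_cast
  have h1 : ((-1 : ℂ) ^ k.succ) ≠ 0 := by simp
  have h2 : ((2 * k.succ).factorial : ℂ) ≠ 0 := by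
    exact_mod_cast Nat.factorial_ne_zero _
  rw [pow_succ (-1 : ℂ) (k.succ), show 2 * k.succ = 2 * k + 1 + 1 by rw [Nat.succ_eq_add_one]; ring,
    pow_succ (2 : ℂ) (2 * k + 1)] at *
  field_simp

theorem nzetaE_of_even {p : ℕ} (hp : Even p) (h0 : p ≠ 0) : nzetaE p = betaE p • 1 := by
  obtain ⟨k, rfl⟩ := hp
  rw [← two_mul] at *
  have hk : k ≠ 0 := by omega
  have h := zetaSeries_ev_of_hasSum (by omega) (hasSum_zeta_nat hk)
  rw [nzetaE, zetaE, if_neg (by omega), h, div_eq_mul_inv _ ((2 : ℝ) ^ (2 * k))]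
  have := normalize_cst_of_even hk ((2 ^ (2 * k))⁻¹)
  push_cast at this ⊢
  rw [this]
  congr 1
  rw [betaE, pow_succ]
  field_simp

theorem nzetaO_of_even {p : ℕ} (hp : Even p) (h0 : p ≠ 0) : nzetaO p = betaO p • 1 := by
  obtain ⟨k, rfl⟩ := hp
  rw [← two_mul] at *
  have hk : k ≠ 0 := by omega
  have h := zetaSeries_od_of_hasSum (by omega) (hasSum_zeta_nat hk)
  rw [nzetaO, zetaO, if_neg (by omega), h, div_eq_mul_inv _ ((2 : ℝ) ^ (2 * k)),
    ← mul_one_sub]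
  have := normalize_cst_of_even hk (1 - (2 ^ (2 * k))⁻¹)
  push_cast at this ⊢
  rw [this]
  congr 1
  rw [betaO]
  field_simp

/-! ### The part linear in the series g -/

theorem sum_kron_smul {M : Type*} [AddCommGroup M] [Module ℚ M] {N c d : ℕ} (h : c + d = N)
    (f : ℕ × ℕ → M) : ∑ p ∈ antidiagonal N, kron (p.1 + 1) (c + 1) • f p = f (c, d) := by
  rw [Finset.sum_eq_single (c, d)]
  · simp [kron]
  · rintro ⟨i, j⟩ hp hne
    rw [mem_antidiagonal] at hp
    have : i ≠ c := by
      rintro rfl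
      simp only at hp
      exact hne (by ext <;> simp; omega)
    simp [kron, this]
  · intro hn
    exact absurd (by rw [mem_antidiagonal]; exact h) hn

theorem sum_choose_mul_kron (a i j N : ℕ) (h : i + j = N) :
    ∑ p ∈ antidiagonal N, (p.1.choose a : ℚ) * kron (i + 1) (p.2 + 1) = j.choose a := by
  rw [Finset.sum_eq_single (j, i)]
  · simp [kron]
  · rintro ⟨i', j'⟩ hp hne
    rw [mem_antidiagonal] at hp
    have : i ≠ j' := by
      rintro rfl
      simp only at hp
      exact hne (by ext <;> simp; omega)
    simp [kron, this]
  · intro hn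
    exact absurd (by rw [mem_antidiagonal]; simp only; omega) hn

theorem sum_sum_antidiagonal_comm {R : Type*} [AddCommMonoid R] {N : ℕ} (F : ℕ × ℕ → ℕ × ℕ → R) :
    ∑ p ∈ antidiagonal N, ∑ q ∈ antidiagonal (p.1 + p.2), F p q
      = ∑ q ∈ antidiagonal N, ∑ p ∈ antidiagonal N, F p q := by
  rw [Finset.sum_comm]
  refine Finset.sum_congr rfl fun p hp => ?_
  rw [mem_antidiagonal] at hp
  rw [hp]

theorem eq_of_eq_add_add {R : Type*} [AddCommMonoid R] {x y z w : R} (hy : y = 0) (hz : z = 0)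
    (h : x = y + z + w) : x = w := by
  rw [h, hy, hz, zero_add, zero_add]

section LinearPart

variable {R : Type*} [CommRing R] [Algebra ℚ R] (xo xe go ge : ℕ → R)

/-- The sum of the `S^{eo}_{r,s}(x; p, h)`, with all indices shifted by one. -/
def sumEO (a b : ℕ) : R := ∑ p ∈ antidiagonal (a + b),
  ((cfOne (b + 1) (p.1 + 1) + kron (p.1 + 1) (b + 1)) • (xo p.1 * ge p.2)
    + cfTwo (a + 1) (p.1 + 1) • (xo p.1 * go p.2))

/-- The sum of the `S^{oe}_{r,s}(x; p, h)`, with all indices shifted by one. -/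
def sumOE (a b : ℕ) : R := ∑ p ∈ antidiagonal (a + b),
  (cfOne (b + 1) (p.1 + 1) • (xo p.1 * go p.2) + kron (p.1 + 1) (b + 1) • (xe p.1 * go p.2)
    + cfTwo (a + 1) (p.1 + 1) • (xo p.1 * ge p.2))

/-- The sum of the `S^{oo}_{r,s}(x; p, h)`, with all indices shifted by one. -/
def sumOO (a b : ℕ) : R := ∑ p ∈ antidiagonal (a + b),
  ((cfOne (b + 1) (p.1 + 1) + cfTwo (a + 1) (p.1 + 1)) • (xe p.1 * go p.2)
    + kron (p.1 + 1) (b + 1) • (xo p.1 * go p.2))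

/-- The coefficient of each product x_i g_j is a binomial sum. Those of xo·go and xe·go arising from
`cfOne` cancel against the Kronecker deltas, and `cfTwo` sums to deltas. No property of the
constants is needed. -/
theorem sum_shuffle_od_ev (a b : ℕ) :
    ∑ p ∈ antidiagonal (a + b), ((p.1.choose a : ℚ) • sumOE xo xe go ge p.1 p.2
      + (p.1.choose b : ℚ) • sumOO xo xe go p.1 p.2) = xo a * ge b + xe b * go a := by
  have key : ∑ p ∈ antidiagonal (a + b), ((p.1.choose a : ℚ) • sumOE xo xe go ge p.1 p.2
      + (p.1.choose b : ℚ) • sumOO xo xe go p.1 p.2)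
      = ∑ q ∈ antidiagonal (a + b), (kron (q.1 + 1) (a + 1) • (xo q.1 * ge q.2)
        + kron (q.1 + 1) (b + 1) • (xe q.1 * go q.2)) := by
    simp only [sumOE, sumOO, Finset.smul_sum, ← Finset.sum_add_distrib]
    rw [sum_sum_antidiagonal_comm]
    refine Finset.sum_congr rfl ?_
    rintro ⟨i, j⟩ hq
    rw [mem_antidiagonal] at hq
    simp only at hq ⊢
    have h1 := sum_choose_mul_cfOne a b i j hq
    have h2 := sum_choose_mul_cfOne b a i j (by omega)
    have h3 := sum_choose_mul_cfTwo a b i (by omega)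
    have h4 := sum_choose_mul_cfTwo b a i (by omega)
    rw [add_comm b a] at h2 h4
    have h5 := sum_choose_mul_kron a i j _ hq
    have h6 := sum_choose_mul_kron b i j _ hq
    rw [← h3, ← h4]
    have z1 : (∑ p ∈ antidiagonal (a + b), (p.1.choose a : ℚ) * cfOne (p.2 + 1) (i + 1)
        + ∑ p ∈ antidiagonal (a + b), (p.1.choose b : ℚ) * kron (i + 1) (p.2 + 1))
          • (xo i * go j) = 0 := by rw [h1, h6, neg_add_cancel, zero_smul]
    have z2 : (∑ p ∈ antidiagonal (a + b), (p.1.choose b : ℚ) * cfOne (p.2 + 1) (i + 1)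
        + ∑ p ∈ antidiagonal (a + b), (p.1.choose a : ℚ) * kron (i + 1) (p.2 + 1))
          • (xe i * go j) = 0 := by rw [h2, h5, neg_add_cancel, zero_smul]
    refine eq_of_eq_add_add z1 z2 ?_
    simp only [Finset.sum_smul, ← Finset.sum_add_distrib]
    refine Finset.sum_congr rfl fun p _ => ?_
    module
  rw [key, Finset.sum_add_distrib, sum_kron_smul rfl, sum_kron_smul (add_comm b a)]

theorem sum_shuffle_od_od (a b : ℕ) :
    ∑ p ∈ antidiagonal (a + b), ((p.1.choose a : ℚ) + p.1.choose b) • sumEO xo go ge p.1 p.2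
      = xo a * go b + xo b * go a := by
  have key : ∑ p ∈ antidiagonal (a + b),
      ((p.1.choose a : ℚ) + p.1.choose b) • sumEO xo go ge p.1 p.2
      = ∑ q ∈ antidiagonal (a + b), (kron (q.1 + 1) (a + 1) • (xo q.1 * go q.2)
        + kron (q.1 + 1) (b + 1) • (xo q.1 * go q.2)) := by
    simp only [sumEO, Finset.smul_sum]
    rw [sum_sum_antidiagonal_comm]
    refine Finset.sum_congr rfl ?_
    rintro ⟨i, j⟩ hq
    rw [mem_antidiagonal] at hq
    simp only at hq ⊢
    have h1 := sum_choose_mul_cfOne a b i j hq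
    have h2 := sum_choose_mul_cfOne b a i j (by omega)
    have h3 := sum_choose_mul_cfTwo a b i (by omega)
    have h4 := sum_choose_mul_cfTwo b a i (by omega)
    rw [add_comm b a] at h2 h4
    have h5 := sum_choose_mul_kron a i j _ hq
    have h6 := sum_choose_mul_kron b i j _ hq
    rw [← h3, ← h4]
    have z1 : (∑ p ∈ antidiagonal (a + b), (p.1.choose a : ℚ) * cfOne (p.2 + 1) (i + 1)
        + ∑ p ∈ antidiagonal (a + b), (p.1.choose b : ℚ) * kron (i + 1) (p.2 + 1))
          • (xo i * ge j) = 0 := by rw [h1, h6, neg_add_cancel, zero_smul]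
    have z2 : (∑ p ∈ antidiagonal (a + b), (p.1.choose b : ℚ) * cfOne (p.2 + 1) (i + 1)
        + ∑ p ∈ antidiagonal (a + b), (p.1.choose a : ℚ) * kron (i + 1) (p.2 + 1))
          • (xo i * ge j) = 0 := by rw [h2, h5, neg_add_cancel, zero_smul]
    refine eq_of_eq_add_add z1 z2 ?_
    simp only [Finset.sum_smul, ← Finset.sum_add_distrib]
    refine Finset.sum_congr rfl fun p _ => ?_
    module
  rw [key, Finset.sum_add_distrib, sum_kron_smul rfl, sum_kron_smul (add_comm b a)]

/-- The `cfOne` and `cfTwo` terms combine with factor 1 + (-1)^p, so only constants of even weight p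
matter; `ho` makes these rational. -/
theorem sum_stuffle_od_ev (bo : ℕ → ℚ)
    (ho : ∀ i, (1 + (-1) ^ (i + 1) : ℚ) • xo i = ((1 + (-1) ^ (i + 1)) * bo i) • 1) (a b : ℕ) :
    sumOE xo xe go ge a b + sumEO xo go ge b a = xo a * ge b + xe b * go a
      - ∑ p ∈ antidiagonal (a + b),
        ((((1 + (-1) ^ (p.1 + 1)) * bo p.1) * ((-1) ^ b * p.1.choose b)) • go p.2
        + (((1 + (-1) ^ (p.1 + 1)) * bo p.1) * ((-1) ^ a * p.1.choose a)) • ge p.2) := by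
  have e1 := sum_kron_smul (rfl : a + b = a + b) (fun q => xo q.1 * ge q.2)
  have e2 := sum_kron_smul (add_comm b a) (fun q => xe q.1 * go q.2)
  simp only at e1 e2
  rw [← e1, ← e2, sumOE, sumEO, add_comm b a, ← Finset.sum_add_distrib, ← Finset.sum_add_distrib,
    ← Finset.sum_sub_distrib]
  refine Finset.sum_congr rfl fun p _ => ?_
  have h : ∀ y : R, (1 + (-1) ^ (p.1 + 1) : ℚ) • (xo p.1 * y)
      = ((1 + (-1) ^ (p.1 + 1)) * bo p.1) • y := by
    intro y
    rw [← smul_mul_assoc, ho, smul_mul_assoc, one_mul]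
  simp only [cfOne_succ, cfTwo_succ]
  have h1 : ∀ (c : ℚ) (y : R), (((1 + (-1) ^ (p.1 + 1)) * bo p.1) * c) • y
      = c • (1 + (-1) ^ (p.1 + 1) : ℚ) • (xo p.1 * y) := by
    intro c y
    rw [h, mul_comm, mul_smul]
  rw [h1, h1]
  module

theorem sum_stuffle_od_od (be : ℕ → ℚ)
    (he : ∀ i, (1 + (-1) ^ (i + 1) : ℚ) • xe i = ((1 + (-1) ^ (i + 1)) * be i) • 1) (a b : ℕ) :
    sumOO xo xe go a b + sumOO xo xe go b a = xo a * go b + xo b * go a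
      - ∑ p ∈ antidiagonal (a + b), (((1 + (-1) ^ (p.1 + 1)) * be p.1)
        * ((-1) ^ b * p.1.choose b + (-1) ^ a * p.1.choose a)) • go p.2 := by
  have e1 := sum_kron_smul (rfl : a + b = a + b) (fun q => xo q.1 * go q.2)
  have e2 := sum_kron_smul (add_comm b a) (fun q => xo q.1 * go q.2)
  simp only at e1 e2
  rw [← e1, ← e2, sumOO, sumOO, add_comm b a, ← Finset.sum_add_distrib, ← Finset.sum_add_distrib,
    ← Finset.sum_sub_distrib]
  refine Finset.sum_congr rfl fun p _ => ?_
  have h : ∀ y : R, (1 + (-1) ^ (p.1 + 1) : ℚ) • (xe p.1 * y)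
      = ((1 + (-1) ^ (p.1 + 1)) * be p.1) • y := by
    intro y
    rw [← smul_mul_assoc, he, smul_mul_assoc, one_mul]
  simp only [cfOne_succ, cfTwo_succ]
  rw [mul_comm _ ((-1) ^ b * (p.1.choose b : ℚ) + (-1) ^ a * (p.1.choose a : ℚ)),
    mul_smul, ← h]
  module

end LinearPart

/-! ### Assembling the Eisenstein series -/

/-- The constant terms `ζ̃^o(i + 1) + δ_{i,0} / 8`. -/
def regO (i : ℕ) : PowerSeries (Polynomial ℂ) :=
  betaO (i + 1) • 1 + if Odd (i + 1) then nzetaO (i + 1) else 0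

/-- The constant terms `ζ̃^e(i + 1) + δ_{i,0} / 8`. -/
def regE (i : ℕ) : PowerSeries (Polynomial ℂ) :=
  betaE (i + 1) • 1 + if Odd (i + 1) then nzetaE (i + 1) else 0

/-- The series `g^o_{j + 1}` in `ℂ[T][[q]]`. -/
def qO (j : ℕ) : PowerSeries (Polynomial ℂ) := incl (g .od (j + 1))

/-- The series `g^e_{j + 1}` in `ℂ[T][[q]]`. -/
def qE (j : ℕ) : PowerSeries (Polynomial ℂ) := incl (g .ev (j + 1))

theorem regO_eq (i : ℕ) : regO i = nzetaO (i + 1) + ((1 / 8 : ℚ) * kron (i + 1) 1) • 1 := by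
  rw [regO]
  rcases Nat.even_or_odd (i + 1) with h | h
  · rw [if_neg (Nat.not_odd_iff_even.2 h), nzetaO_of_even h (Nat.succ_ne_zero i)]
    have : i ≠ 0 := by rintro rfl; simp at h
    simp [kron, this]
  · rw [if_pos h, add_comm]
    congr 2
    rcases eq_or_ne i 0 with rfl | hi
    · norm_num [kron, betaO]
    · simp [kron, hi, betaO, bernoulli_eq_zero_of_odd h (by omega)]

theorem regE_eq (i : ℕ) : regE i = nzetaE (i + 1) + ((1 / 8 : ℚ) * kron (i + 1) 1) • 1 := by
  rw [regE]
  rcases Nat.even_or_odd (i + 1) with h | h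
  · rw [if_neg (Nat.not_odd_iff_even.2 h), nzetaE_of_even h (Nat.succ_ne_zero i)]
    have : i ≠ 0 := by rintro rfl; simp at h
    simp [kron, this]
  · rw [if_pos h, add_comm]
    congr 2
    rcases eq_or_ne i 0 with rfl | hi
    · norm_num [kron, betaE]
    · simp [kron, hi, betaE, bernoulli_eq_zero_of_odd h (by omega)]

theorem smul_regO (i : ℕ) :
    (1 + (-1) ^ (i + 1) : ℚ) • regO i = ((1 + (-1) ^ (i + 1)) * betaO (i + 1)) • 1 := by
  rw [regO]
  rcases Nat.even_or_odd (i + 1) with h | h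
  · rw [if_neg (Nat.not_odd_iff_even.2 h), add_zero, mul_smul]
  · rw [h.neg_one_pow]
    simp

theorem smul_regE (i : ℕ) :
    (1 + (-1) ^ (i + 1) : ℚ) • regE i = ((1 + (-1) ^ (i + 1)) * betaE (i + 1)) • 1 := by
  rw [regE]
  rcases Nat.even_or_odd (i + 1) with h | h
  · rw [if_neg (Nat.not_odd_iff_even.2 h), add_zero, mul_smul]
  · rw [h.neg_one_pow]
    simp

/-- The rational part and the imaginary part use the same bilinear form, so their constants simply
add up to `regO`. -/
theorem incl_betaEO_add_imagEO (a b : ℕ) :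
    incl (betaEO (a + 1) (b + 1)) + imagEO (a + 1) (b + 1) = sumEO regO qO qE a b := by
  rw [betaEO, imagEO, sumEO, show a + 1 + (b + 1) = a + b + 2 by ring, Finset.sum_filter,
    sum_posPairs, sum_posPairs, map_sum, ← Finset.sum_add_distrib]
  refine Finset.sum_congr rfl fun p _ => ?_
  simp only [regO, qO, qE, map_add, incl_smul]
  split_ifs <;> simp only [add_mul, smul_mul_assoc, one_mul, mul_smul_comm, zero_mul] <;> module

theorem incl_betaOE_add_imagOE (a b : ℕ) :
    incl (betaOE (a + 1) (b + 1)) + imagOE (a + 1) (b + 1) = sumOE regO regE qO qE a b := by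
  rw [betaOE, imagOE, sumOE, show a + 1 + (b + 1) = a + b + 2 by ring, Finset.sum_filter,
    sum_posPairs, sum_posPairs, map_sum, ← Finset.sum_add_distrib]
  refine Finset.sum_congr rfl fun p _ => ?_
  simp only [regO, regE, qO, qE, map_add, incl_smul]
  split_ifs <;> simp only [add_mul, smul_mul_assoc, one_mul, mul_smul_comm, zero_mul] <;> module

theorem incl_betaOO_add_imagOO (a b : ℕ) :
    incl (betaOO (a + 1) (b + 1)) + imagOO (a + 1) (b + 1) = sumOO regO regE qO a b := by
  rw [betaOO, imagOO, sumOO, show a + 1 + (b + 1) = a + b + 2 by ring, Finset.sum_filter,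
    sum_posPairs, sum_posPairs, map_sum, ← Finset.sum_add_distrib]
  refine Finset.sum_congr rfl fun p _ => ?_
  simp only [regO, regE, qO, map_add, incl_smul]
  split_ifs <;> simp only [add_mul, smul_mul_assoc, one_mul, mul_smul_comm, zero_mul] <;> module

theorem GEO_succ_succ (a b : ℕ) : GEO (a + 1) (b + 1)
    = normalize (a + b + 2) (zetaEO (a + 1) (b + 1)) + incl (gg .ev .od (a + 1) (b + 1))
      + sumEO regO qO qE a b + (1 / 4 : ℚ) • incl (epsEO (a + 1) (b + 1)) := by
  rw [← incl_betaEO_add_imagEO, GEO, combEO, map_add, map_add, incl_smul,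
    show a + 1 + (b + 1) = a + b + 2 by ring]
  ring

theorem GOE_succ_succ (a b : ℕ) : GOE (a + 1) (b + 1)
    = normalize (a + b + 2) (zetaOE (a + 1) (b + 1)) + incl (gg .od .ev (a + 1) (b + 1))
      + sumOE regO regE qO qE a b + (1 / 4 : ℚ) • incl (epsOE (a + 1) (b + 1)) := by
  rw [← incl_betaOE_add_imagOE, GOE, combOE, map_add, map_add, incl_smul,
    show a + 1 + (b + 1) = a + b + 2 by ring]
  ring

theorem GOO_succ_succ (a b : ℕ) : GOO (a + 1) (b + 1)
    = normalize (a + b + 2) (zetaOO (a + 1) (b + 1)) + incl (gg .od .od (a + 1) (b + 1))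
      + sumOO regO regE qO a b + (1 / 4 : ℚ) • incl (epsOO (a + 1) (b + 1)) := by
  rw [← incl_betaOO_add_imagOO, GOO, combOO, map_add, map_add, incl_smul,
    show a + 1 + (b + 1) = a + b + 2 by ring]
  ring

theorem incl_g_od_ev_stuffle (a b : ℕ) : qO a * qE b
    = incl (gg .od .ev (a + 1) (b + 1)) + incl (gg .ev .od (b + 1) (a + 1))
      - ∑ p ∈ antidiagonal (a + b),
        ((((1 + (-1) ^ (p.1 + 1)) * betaO (p.1 + 1)) * ((-1) ^ b * p.1.choose b)) • qO p.2
        + (((1 + (-1) ^ (p.1 + 1)) * betaO (p.1 + 1)) * ((-1) ^ a * p.1.choose a)) • qE p.2)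
      + (1 / 4 : ℚ) • (kron (b + 1) 1 • qO a + kron (a + 1) 1 • qE b) := by
  have e := congrArg incl (g_od_ev_stuffle a b)
  simp only [map_mul, map_add, map_sum, incl_smul] at e
  change qO a * qE b = _ at e
  rw [e, sub_add, sub_eq_add_neg]
  congr 1
  -- The exceptional 1/4 sits at p.1 = 0, where the binomial coefficients reduce to deltas in a and
  -- b.
  have h0 := sum_kron_smul (zero_add (a + b))
    (fun p => (1 / 4 * ((-1) ^ b * p.1.choose b) : ℚ) • qO p.2
      + (1 / 4 * ((-1) ^ a * p.1.choose a) : ℚ) • qE p.2)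
  have h1 : (1 / 4 : ℚ) • (kron (b + 1) 1 • qO a + kron (a + 1) 1 • qE b)
      = (1 / 4 * ((-1) ^ b * Nat.choose 0 b) : ℚ) • qO (a + b)
      + (1 / 4 * ((-1) ^ a * Nat.choose 0 a) : ℚ) • qE (a + b) := by
    rw [smul_add, smul_smul, smul_smul]
    congr 1
    · cases b <;> simp [kron]
    · cases a <;> simp [kron]
  rw [h1, ← h0, ← Finset.sum_sub_distrib, ← Finset.sum_neg_distrib]
  refine Finset.sum_congr rfl fun p _ => ?_
  rw [neg_half_mul_eulerO]
  simp only [kron, add_left_inj]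
  change _ • qO p.2 + _ • qE p.2 = _
  split_ifs <;> module

theorem incl_g_od_od_stuffle (a b : ℕ) : qO a * qO b
    = incl (gg .od .od (a + 1) (b + 1)) + incl (gg .od .od (b + 1) (a + 1))
      - ∑ p ∈ antidiagonal (a + b), (((1 + (-1) ^ (p.1 + 1)) * betaE (p.1 + 1))
        * ((-1) ^ b * p.1.choose b + (-1) ^ a * p.1.choose a)) • qO p.2
      + (1 / 4 : ℚ) • (kron (b + 1) 1 • qO a + kron (a + 1) 1 • qO b)
      + incl (g .od (a + b + 2)) := by
  have e := congrArg incl (g_od_od_stuffle a b)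
  simp only [map_mul, map_add, map_sum, incl_smul] at e
  change qO a * qO b = _ at e
  rw [e, ← add_assoc]
  congr 1
  rw [sub_add, sub_eq_add_neg]
  congr 1
  have h0 := sum_kron_smul (zero_add (a + b))
    (fun p => (1 / 4 * ((-1) ^ b * p.1.choose b) : ℚ) • qO p.2
      + (1 / 4 * ((-1) ^ a * p.1.choose a) : ℚ) • qO p.2)
  have h1 : (1 / 4 : ℚ) • (kron (b + 1) 1 • qO a + kron (a + 1) 1 • qO b)
      = (1 / 4 * ((-1) ^ b * Nat.choose 0 b) : ℚ) • qO (a + b)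
      + (1 / 4 * ((-1) ^ a * Nat.choose 0 a) : ℚ) • qO (a + b) := by
    rw [smul_add, smul_smul, smul_smul]
    congr 1
    · cases b <;> simp [kron]
    · cases a <;> simp [kron]
  rw [h1, ← h0, ← Finset.sum_sub_distrib, ← Finset.sum_neg_distrib]
  refine Finset.sum_congr rfl fun p _ => ?_
  rw [neg_half_mul_eulerE]
  simp only [kron, add_left_inj]
  change _ • qO p.2 = _
  split_ifs <;> module

theorem regO_mul (i : ℕ) (y : PowerSeries (Polynomial ℂ)) :
    regO i * y = nzetaO (i + 1) * y + (1 / 8 : ℚ) • kron (i + 1) 1 • y := by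
  rw [regO_eq, add_mul, smul_mul_assoc, one_mul, mul_smul]

theorem regE_mul (i : ℕ) (y : PowerSeries (Polynomial ℂ)) :
    regE i * y = nzetaE (i + 1) * y + (1 / 8 : ℚ) • kron (i + 1) 1 • y := by
  rw [regE_eq, add_mul, smul_mul_assoc, one_mul, mul_smul]

/-- The terms with 1/8 turn the zeta values in the mixed products into `regO` and `regE`. -/
theorem GO_mul_GE_add (a b : ℕ) : GO (a + 1) * GE (b + 1)
      + (1 / 8 : ℚ) • (kron (a + 1) 1 • qE b + kron (b + 1) 1 • qO a)
    = normalize (a + b + 2) (zetaO (a + 1) * zetaE (b + 1)) + (regO a * qE b + regE b * qO a)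
      + qO a * qE b := by
  rw [regO_mul, regE_mul, show a + b + 2 = a + 1 + (b + 1) by ring, ← normalize_mul_normalize,
    smul_add]
  simp only [GO, GE, nzetaO, nzetaE, qO, qE]
  ring

theorem GO_mul_GO_add (a b : ℕ) : GO (a + 1) * GO (b + 1)
      + (1 / 8 : ℚ) • (kron (a + 1) 1 • qO b + kron (b + 1) 1 • qO a)
    = normalize (a + b + 2) (zetaO (a + 1) * zetaO (b + 1)) + (regO a * qO b + regO b * qO a)
      + qO a * qO b := by
  rw [regO_mul, regO_mul, show a + b + 2 = a + 1 + (b + 1) by ring, ← normalize_mul_normalize,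
    smul_add]
  simp only [GO, nzetaO, qO]
  ring

theorem GO_mul_GE_stuffle (a b : ℕ) (h : a + b ≠ 0) :
    GO (a + 1) * GE (b + 1)
        + incl ((1 / 4 : ℚ) • (kron (a + 1) 2 • gbar .ev (b + 1)
            + kron (b + 1) 2 • gbar .od (a + 1)))
        + incl ((1 / 8 : ℚ) • (kron (a + 1) 1 • g .ev (b + 1) + kron (b + 1) 1 • g .od (a + 1)))
      = GOE (a + 1) (b + 1) + GEO (b + 1) (a + 1) := by
  have h1 := GO_mul_GE_add a b
  have h2 := sum_stuffle_od_ev regO regE qO qE (fun i => betaO (i + 1)) smul_regO a b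
  have h3 := incl_g_od_ev_stuffle a b
  have h4 := congrArg (fun f => (1 / 4 : ℚ) • incl f) (epsOE_add_epsEO a b h)
  have h5 := congrArg (normalize (a + b + 2)) (zetaO_mul_zetaE_stuffle a b h)
  rw [GOE_succ_succ, GEO_succ_succ, add_comm b a]
  simp only [map_add, incl_smul, normalize_add, smul_add] at h1 h3 h4 h5 ⊢
  simp only [qO, qE] at *
  linear_combination h1 - h2 + h3 - h4 + h5

theorem GO_mul_GO_stuffle (a b : ℕ) (h : a + b ≠ 0) :
    GO (a + 1) * GO (b + 1)
        + incl ((1 / 4 : ℚ) • (kron (a + 1) 2 • gbar .od (b + 1)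
            + kron (b + 1) 2 • gbar .od (a + 1)))
        + incl ((1 / 8 : ℚ) • (kron (a + 1) 1 • g .od (b + 1) + kron (b + 1) 1 • g .od (a + 1)))
      = GOO (a + 1) (b + 1) + GOO (b + 1) (a + 1) + GO (a + b + 2) := by
  have h1 := GO_mul_GO_add a b
  have h2 := sum_stuffle_od_od regO regE qO (fun i => betaE (i + 1)) smul_regE a b
  have h3 := incl_g_od_od_stuffle a b
  have h4 := congrArg (fun f => (1 / 4 : ℚ) • incl f) (epsOO_add_epsOO a b h)
  have h5 := congrArg (normalize (a + b + 2)) (zetaO_mul_zetaO_stuffle a b h)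
  have h6 : GO (a + b + 2) = normalize (a + b + 2) (zetaO (a + b + 2))
      + incl (g .od (a + b + 2)) := rfl
  rw [GOO_succ_succ, GOO_succ_succ, h6, add_comm b a]
  simp only [map_add, incl_smul, normalize_add, smul_add] at h1 h3 h4 h5 ⊢
  simp only [qO] at *
  linear_combination h1 - h2 + h3 - h4 + h5

theorem GO_mul_GE_shuffle (a b : ℕ) (h : a + b ≠ 0) :
    GO (a + 1) * GE (b + 1)
        + incl ((1 / 4 : ℚ) • (kron (a + 1) 2 • gbar .ev (b + 1)
            + kron (b + 1) 2 • gbar .od (a + 1)))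
        + incl ((1 / 8 : ℚ) • (kron (a + 1) 1 • g .ev (b + 1) + kron (b + 1) 1 • g .od (a + 1)))
      = ∑ p ∈ antidiagonal (a + b), (p.1.choose a • GOE (p.1 + 1) (p.2 + 1)
          + p.1.choose b • GOO (p.1 + 1) (p.2 + 1)) := by
  have e : ∑ p ∈ antidiagonal (a + b), (p.1.choose a • GOE (p.1 + 1) (p.2 + 1)
          + p.1.choose b • GOO (p.1 + 1) (p.2 + 1))
      = normalize (a + b + 2) (∑ p ∈ antidiagonal (a + b),
        (p.1.choose a • zetaOE (p.1 + 1) (p.2 + 1) + p.1.choose b • zetaOO (p.1 + 1) (p.2 + 1)))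
      + incl (∑ p ∈ antidiagonal (a + b), ((p.1.choose a : ℚ) • gg .od .ev (p.1 + 1) (p.2 + 1)
          + (p.1.choose b : ℚ) • gg .od .od (p.1 + 1) (p.2 + 1)))
      + ∑ p ∈ antidiagonal (a + b), ((p.1.choose a : ℚ) • sumOE regO regE qO qE p.1 p.2
          + (p.1.choose b : ℚ) • sumOO regO regE qO p.1 p.2)
      + (1 / 4 : ℚ) • incl (∑ p ∈ antidiagonal (a + b), ((p.1.choose a : ℚ)
          • epsOE (p.1 + 1) (p.2 + 1) + (p.1.choose b : ℚ) • epsOO (p.1 + 1) (p.2 + 1))) := by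
    simp only [normalize_sum, map_sum, Finset.smul_sum, ← Finset.sum_add_distrib]
    refine Finset.sum_congr rfl fun p hp => ?_
    rw [mem_antidiagonal] at hp
    simp only [normalize_add, normalize_nsmul]
    simp only [GOE_succ_succ, GOO_succ_succ, hp, map_add, incl_smul,
      ← Nat.cast_smul_eq_nsmul ℚ]
    module
  have h1 := GO_mul_GE_add a b
  have h3 := congrArg incl (g_shuffle .od .ev .od (by simp [Par.sgn]) a b)
  rw [e, sum_shuffle_od_ev, epsOE_shuffle a b h, ← zetaO_mul_zetaE_shuffle a b h]
  rw [map_mul, map_add] at h3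
  change qO a * qE b = _ at h3
  rw [h3] at h1
  simp only [map_add, incl_smul, smul_add] at h1 ⊢
  simp only [qO, qE] at *
  linear_combination (norm := module) h1

theorem GO_mul_GO_shuffle (a b : ℕ) (h : a + b ≠ 0) :
    GO (a + 1) * GO (b + 1)
        + incl ((1 / 4 : ℚ) • (kron (a + 1) 2 • gbar .od (b + 1)
            + kron (b + 1) 2 • gbar .od (a + 1)))
        + incl ((1 / 8 : ℚ) • (kron (a + 1) 1 • g .od (b + 1) + kron (b + 1) 1 • g .od (a + 1)))
      = ∑ p ∈ antidiagonal (a + b), (p.1.choose a + p.1.choose b) • GEO (p.1 + 1) (p.2 + 1) := by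
  have e : ∑ p ∈ antidiagonal (a + b), (p.1.choose a + p.1.choose b) • GEO (p.1 + 1) (p.2 + 1)
      = normalize (a + b + 2) (∑ p ∈ antidiagonal (a + b),
        (p.1.choose a • zetaEO (p.1 + 1) (p.2 + 1) + p.1.choose b • zetaEO (p.1 + 1) (p.2 + 1)))
      + incl (∑ p ∈ antidiagonal (a + b), ((p.1.choose a : ℚ) • gg .ev .od (p.1 + 1) (p.2 + 1)
          + (p.1.choose b : ℚ) • gg .ev .od (p.1 + 1) (p.2 + 1)))
      + ∑ p ∈ antidiagonal (a + b),
          ((p.1.choose a : ℚ) + p.1.choose b) • sumEO regO qO qE p.1 p.2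
      + (1 / 4 : ℚ) • incl (∑ p ∈ antidiagonal (a + b),
          ((p.1.choose a : ℚ) + p.1.choose b) • epsEO (p.1 + 1) (p.2 + 1)) := by
    simp only [normalize_sum, map_sum, Finset.smul_sum, ← Finset.sum_add_distrib]
    refine Finset.sum_congr rfl fun p hp => ?_
    rw [mem_antidiagonal] at hp
    simp only [normalize_add, normalize_nsmul]
    simp only [GEO_succ_succ, hp, map_add, incl_smul,
      ← Nat.cast_smul_eq_nsmul ℚ, Nat.cast_add]
    module
  have h1 := GO_mul_GO_add a b
  have h3 := congrArg incl (g_shuffle .od .od .ev (fun u => by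
    simp [Par.sgn, ← mul_pow]) a b)
  rw [e, sum_shuffle_od_od, epsEO_shuffle a b h, ← zetaO_mul_zetaO_shuffle a b h]
  rw [map_mul, map_add] at h3
  change qO a * qO b = _ at h3
  rw [h3] at h1
  simp only [map_add, incl_smul, smul_add] at h1 ⊢
  simp only [qO] at *
  linear_combination (norm := module) h1

end

end LevelTwo

theorem theorem3 (r s : ℕ) (hr : 1 ≤ r) (hs : 1 ≤ s) (hrs : (r, s) ≠ (1, 1)) :
    (LevelTwo.GO r * LevelTwo.GE s
        + LevelTwo.incl ((1 / 4 : ℚ) • (LevelTwo.kron r 2 • LevelTwo.gbar .ev s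
            + LevelTwo.kron s 2 • LevelTwo.gbar .od r))
        + LevelTwo.incl ((1 / 8 : ℚ) • (LevelTwo.kron r 1 • LevelTwo.g .ev s
            + LevelTwo.kron s 1 • LevelTwo.g .od r))
      = LevelTwo.GOE r s + LevelTwo.GEO s r) ∧
    (LevelTwo.GOE r s + LevelTwo.GEO s r
      = ∑ x ∈ LevelTwo.posPairs (r + s),
          (((x.1 - 1).choose (r - 1)) • LevelTwo.GOE x.1 x.2
            + ((x.1 - 1).choose (s - 1)) • LevelTwo.GOO x.1 x.2)) ∧
    (LevelTwo.GO r * LevelTwo.GO s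
        + LevelTwo.incl ((1 / 4 : ℚ) • (LevelTwo.kron r 2 • LevelTwo.gbar .od s
            + LevelTwo.kron s 2 • LevelTwo.gbar .od r))
        + LevelTwo.incl ((1 / 8 : ℚ) • (LevelTwo.kron r 1 • LevelTwo.g .od s
            + LevelTwo.kron s 1 • LevelTwo.g .od r))
      = LevelTwo.GOO r s + LevelTwo.GOO s r + LevelTwo.GO (r + s)) ∧
    (LevelTwo.GOO r s + LevelTwo.GOO s r + LevelTwo.GO (r + s)
      = ∑ x ∈ LevelTwo.posPairs (r + s),
          ((x.1 - 1).choose (r - 1) + (x.1 - 1).choose (s - 1)) • LevelTwo.GEO x.1 x.2) := by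
  obtain ⟨a, rfl⟩ := Nat.exists_eq_add_of_le' hr
  obtain ⟨b, rfl⟩ := Nat.exists_eq_add_of_le' hs
  have h : a + b ≠ 0 := by
    rintro h
    obtain ⟨rfl, rfl⟩ : a = 0 ∧ b = 0 := by omega
    exact hrs rfl
  have e : a + 1 + (b + 1) = a + b + 2 := by ring
  have h1 := LevelTwo.GO_mul_GE_stuffle a b h
  have h2 := LevelTwo.GO_mul_GO_stuffle a b h
  rw [e, LevelTwo.sum_posPairs, LevelTwo.sum_posPairs]
  exact ⟨h1, h1.symm.trans (LevelTwo.GO_mul_GE_shuffle a b h), h2,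
    h2.symm.trans (LevelTwo.GO_mul_GO_shuffle a b h)⟩
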